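/- Operation $3I_6$. Let $\pi,\tau,\rho$ be planes in Euclidean space $\mathbb R^3$ with equations $a\cdot x+d=0$, $b\cdot x+e=0$, $c\cdot x+f=0$, and let $P\notin\pi$, $Q\notin\tau$, $R\notin\rho$ be points. For a plane $\Delta$ let $\mathcal F_\Delta$ be the orthogonal reflection in $\Delta$. A fold plane of the operation is a plane $\Delta$ with $\mathcal F_\Delta(P)\in\pi$, $\mathcal F_\Delta(Q)\in\tau$ and $\mathcal F_\Delta(R)\in\rho$. The polynomial system of the operation, in the unknowns $\ell\in\mathbb C$ and $Q',R'\in\mathbb C^3$, is $$b\cdot Q'+e=0,\qquad c\cdot R'+f=0,\qquad Q'-Q=\ell\,(R'-R),$$ together with the following equation for $(X,X')=(Q,Q')$ and for $(X,X')=(R,R')$, where $w=X'-X$ and $\cdot$ is the bilinear dot product on $\mathbb C^3$: $$(a\cdot w)(X'\cdot X'-X\cdot X)=2(P\cdot w)(a\cdot w)-(a\cdot P+d)(w\cdot w).$$ In Cartesian coordinates with $P=(0,0,1)$ and $\pi=\{z=-1\}$ the last equation reads $$2(y-y')^2+2(x-x')^2=-\big((x^2-x'^2)+(y^2-y'^2)+(z^2-z'^2)\big)(z-z'),$$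 where $X=(x,y,z)$ and $X'=(x',y',z')$. Then: 1. If the system has only finitely many complex solutions, it has at most nine. 2. If neither $\tau$ nor $\rho$ is parallel (or equal) to $\pi$, at least two of the complex solutions are non-real, that is, have a non-real coordinate. 3. The map that takes $(\ell,Q',R')$ to the perpendicular bisector plane of $QQ'$ is a bijection from the real solutions of the system onto the fold planes of the operation. 4. If the operation has only finitely many fold planes, it has at most seven. 5. For comparison, in the Euclidean plane: let an operation be one of the seven elementary 2D origami operations, or the fold along a given line. That is, the fold line $\Delta$ is required to satisfy one of the following, with given points $P,Q$ and lines $m,n$: $\mathcal F_\Delta(P)=P$ and $\mathcal F_\Delta(Q)=Q$; $\mathcal F_\Delta(P)=Q$, with $P\ne Q$; $\mathcal F_\Delta(m)=n$, with $m\neq n$; $\mathcal F_\Delta(P)=P$ and $m$ is reversed; $\mathcal F_\Delta(P)\in m$ and $\mathcal F_\Delta(Q)=Q$, with $P\notin m$; $\mathcal F_\Delta(P)\in m$ and $\mathcal F_\Delta(Q)\in n$, with $P\notin m$, $Q\notin n$; $\mathcal F_\Delta(P)\in m$ and $n$ is reversed, with $P\notin m$; $\mathcal F_\Delta(m)=m$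 and every point of $m$ is fixed. Here "$m$ is reversed" means that $\mathcal F_\Delta(m)=m$ and some point of $m$ is moved. If an operation has only finitely many fold lines, it has at most three. -/

import Mathlib

open scoped Matrix

noncomputable section

namespace Origami

/-- Euclidean space of dimension `k`. -/
abbrev E (k : ℕ) := EuclideanSpace ℝ (Fin k)

/-- Affine hyperplanes of `ℝ^k`: lines if `k = 2`, planes if `k = 3`. -/
def Hyperplane (k : ℕ) : Type :=
  {Δ : AffineSubspace ℝ (E k) //
    (Δ : Set (E k)).Nonempty ∧ Module.finrank ℝ Δ.direction + 1 = k}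

/-- The points of a hyperplane. -/
def Hyperplane.points {k : ℕ} (Δ : Hyperplane k) : Set (E k) := (Δ.1 : Set (E k))

/-- The fold `F_Δ`: orthogonal reflection of the whole space in the line or plane `Δ`. -/
def fold {k : ℕ} (Δ : Hyperplane k) : E k → E k :=
  haveI : Nonempty Δ.1 := Δ.2.1.to_subtype
  EuclideanGeometry.reflection Δ.1

/-- The fold planes that place `P` onto `π`, `Q` onto `τ` and `R` onto `ρ`. -/
def foldPlanes (P Q R : E 3) (π τ ρ : Hyperplane 3) : Set (Hyperplane 3) :=
  {Δ | fold Δ P ∈ π.points ∧ fold Δ Q ∈ τ.points ∧ fold Δ R ∈ ρ.points}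

/-- The real vector `x`, seen as a complex vector. -/
def toComplex (x : E 3) : Fin 3 → ℂ := fun i => (x i : ℂ)

/-- The plane `π` has the equation `a ⬝ x + d = 0`. -/
def HasEquation (π : Hyperplane 3) (a : E 3) (d : ℝ) : Prop :=
  ∀ x : E 3, x ∈ π.points ↔ inner ℝ a x + d = 0

/-- Let `π` be the plane `a ⬝ x + d = 0`, and put `w = X' - X`. The plane `Δ` through the midpoint
of `X X'` with normal vector `w` takes `P` to a point `P' = P + k w` of `π` iff
`a ⬝ (P + k w) + d = 0` and `w ⬝ (P + P') = w ⬝ (X + X')`. This is the polynomial equation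
between `X` and `X'` that results by elimination of `k` and clearing the denominator `a ⬝ w`. -/
def FoldEquation (P a : E 3) (d : ℝ) (X X' : Fin 3 → ℂ) : Prop :=
  (toComplex a ⬝ᵥ (X' - X)) * (X' ⬝ᵥ X' - X ⬝ᵥ X) =
    2 * (toComplex P ⬝ᵥ (X' - X)) * (toComplex a ⬝ᵥ (X' - X)) -
      (toComplex a ⬝ᵥ toComplex P + d) * ((X' - X) ⬝ᵥ (X' - X))

/-- Where nothing is divided by zero, the equation says exactly that `P' = P + k w` exists. -/
theorem foldEquation_iff (P a : E 3) (d : ℝ) (X X' : Fin 3 → ℂ)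
    (h : toComplex a ⬝ᵥ (X' - X) ≠ 0) :
    FoldEquation P a d X X' ↔ ∃ k : ℂ,
      toComplex a ⬝ᵥ (toComplex P + k • (X' - X)) + d = 0 ∧
      (X' - X) ⬝ᵥ (toComplex P + (toComplex P + k • (X' - X))) = (X' - X) ⬝ᵥ (X + X') := by
  have e1 : (X' - X) ⬝ᵥ (X + X') = X' ⬝ᵥ X' - X ⬝ᵥ X := by
    simp only [dotProduct, Fin.sum_univ_three, Pi.sub_apply, Pi.add_apply]; ring
  have e2 : ∀ k : ℂ, (X' - X) ⬝ᵥ (toComplex P + (toComplex P + k • (X' - X))) =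
      2 * (toComplex P ⬝ᵥ (X' - X)) + k * ((X' - X) ⬝ᵥ (X' - X)) := by
    intro k
    simp only [dotProduct, Fin.sum_univ_three, Pi.sub_apply, Pi.add_apply, Pi.smul_apply,
      smul_eq_mul]; ring
  simp only [e1, e2, dotProduct_add, dotProduct_smul, smul_eq_mul]
  unfold FoldEquation
  generalize toComplex a ⬝ᵥ (X' - X) = α at *
  constructor
  · intro H
    refine ⟨-(toComplex a ⬝ᵥ toComplex P + d) / α, ?_, ?_⟩
    · field_simp; ring
    · field_simp; linear_combination -H
  · rintro ⟨k, h1, h2⟩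
    linear_combination -α * h2 + ((X' - X) ⬝ᵥ (X' - X)) * h1

/-- In Cartesian coordinates with `P = (0, 0, 1)` and `π` the plane `z = -1`, the equation is
`2 (y - y')² + 2 (x - x')² = -(x² - x'²)(z - z') - (y² - y'²)(z - z') - (z² - z'²)(z - z')`. -/
theorem foldEquation_normalForm (X X' : Fin 3 → ℂ) :
    FoldEquation !₂[0, 0, 1] !₂[0, 0, 1] 1 X X' ↔
      2 * (X 1 - X' 1) ^ 2 + 2 * (X 0 - X' 0) ^ 2 =
        -(X 0 ^ 2 - X' 0 ^ 2) * (X 2 - X' 2) - (X 1 ^ 2 - X' 1 ^ 2) * (X 2 - X' 2)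
          - (X 2 ^ 2 - X' 2 ^ 2) * (X 2 - X' 2) := by
  simp [FoldEquation, toComplex, dotProduct, Fin.sum_univ_three]
  constructor <;> intro h <;> linear_combination h

/-- The complex solutions `(ℓ, Q', R')` of the polynomial system of the fold operation that places
`P` onto `a ⬝ x + d = 0`, `Q` onto `b ⬝ x + e = 0` and `R` onto `c ⬝ x + f = 0`. -/
def complexSolutions (P Q R a b c : E 3) (d e f : ℝ) :
    Set (ℂ × (Fin 3 → ℂ) × (Fin 3 → ℂ)) :=
  {s | FoldEquation P a d (toComplex Q) s.2.1 ∧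
    FoldEquation P a d (toComplex R) s.2.2 ∧
    s.2.1 - toComplex Q = s.1 • (s.2.2 - toComplex R) ∧
    toComplex b ⬝ᵥ s.2.1 + e = 0 ∧
    toComplex c ⬝ᵥ s.2.2 + f = 0}

/-- All coordinates of the solution `(ℓ, Q', R')` are real. -/
def IsRealSolution (s : ℂ × (Fin 3 → ℂ) × (Fin 3 → ℂ)) : Prop :=
  s.1.im = 0 ∧ (∀ i, (s.2.1 i).im = 0) ∧ ∀ i, (s.2.2 i).im = 0

/-- The perpendicular bisector of `Q Q'`, for a real solution `(ℓ, Q', R')`. -/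
def solutionPlane (Q : E 3) (s : ℂ × (Fin 3 → ℂ) × (Fin 3 → ℂ)) : AffineSubspace ℝ (E 3) :=
  AffineSubspace.perpBisector Q (WithLp.toLp 2 fun i => (s.2.1 i).re)

/-- The incidence constraints of origami in the plane. -/
inductive PlanarIncidence : Type
  | pointToPoint (P Q : E 2) (h : P ≠ Q)
  | lineToLine (m n : Hyperplane 2) (h : m ≠ n)
  | pointToLine (P : E 2) (m : Hyperplane 2) (h : P ∉ m.points)
  | pointFixed (P : E 2)
  | lineReversed (m : Hyperplane 2)
  | lineFixed (m : Hyperplane 2)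

/-- The fold line `Δ` satisfies the incidence constraint. -/
def PlanarIncidence.Holds (Δ : Hyperplane 2) : PlanarIncidence → Prop
  | pointToPoint P Q _ => fold Δ P = Q
  | lineToLine m n _ => fold Δ '' m.points = n.points
  | pointToLine P m _ => fold Δ P ∈ m.points
  | pointFixed P => fold Δ P = P
  | lineReversed m => fold Δ '' m.points = m.points ∧ ∃ P ∈ m.points, fold Δ P ≠ P
  | lineFixed m => fold Δ '' m.points = m.points ∧ ∀ P ∈ m.points, fold Δ P = P

/-- The seven elementary fold operations of origami in the plane, and as an eighth one the fold
along a given line. -/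
inductive IsPlanarOperation : List PlanarIncidence → Prop
  | throughTwoPoints (P Q) : IsPlanarOperation [.pointFixed P, .pointFixed Q]
  | pointToPoint (P Q h) : IsPlanarOperation [.pointToPoint P Q h]
  | lineToLine (m n h) : IsPlanarOperation [.lineToLine m n h]
  | perpendicularThrough (P m) : IsPlanarOperation [.pointFixed P, .lineReversed m]
  | pointToLineThrough (P m h Q) : IsPlanarOperation [.pointToLine P m h, .pointFixed Q]
  | pointsToLines (P m h Q n h') :
      IsPlanarOperation [.pointToLine P m h, .pointToLine Q n h']
  | pointToLinePerpendicular (P m h n) :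
      IsPlanarOperation [.pointToLine P m h, .lineReversed n]
  | alongLine (m) : IsPlanarOperation [.lineFixed m]

/-- The fold lines that satisfy all the given constraints. -/
def foldLines (L : List PlanarIncidence) : Set (Hyperplane 2) :=
  {Δ | ∀ I ∈ L, I.Holds Δ}

end Origami

end

/-! Put `v = R' - R`, `α = a ⬝ P + d`, `β = b ⬝ Q + e`, `γ = c ⬝ R + f`; since `Q` and `R` lie off
their planes, `β` and `γ` are non-zero. The linear equations become `c ⬝ v = -γ` and `ℓ (b ⬝ v) =
-β`. Hence `v` runs over an affine plane without the line `b ⬝ v = 0`, and it determines `ℓ`, `Q'`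
and `R'` (`complexSolutions_eq_image`). After clearing denominators, both fold equations become
cubics in `v`, each of the form `(α (b ⬝ v) - β (a ⬝ v)) (v ⬝ v) + 2 (a ⬝ v) ((X - P) ⬝ v) (b ⬝ v) =
0`. Bézout's inequality gives at most nine solutions.

Both cubics vanish where `a ⬝ v = v ⬝ v = 0`. If neither `b` nor `c` is a multiple of `a`, such an
isotropic `v` can be scaled into the affine plane off the removed line. It gives a non-real
solution, and conjugation gives a second one. This leaves at most `9 - 2 = 7` real solutions. If `b`
or `c` is a multiple of `a`, one cubic may be replaced by a conic, and Bézout gives at most six.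

Finiteness does not exclude common components. Over `ℂ`, a common component would have infinitely
many points off the removed line unless it had none there. Over `ℝ`, it may have finitely many
points, but these are singular, so a common factor of degree `k` contributes at most `k (k - 1)` of
them, and `k (k - 1) + (3 - k)² ≤ 6` for `k = 1, 2, 3`.

A real solution is a fold plane because the bisectors of `QQ'` and `RR'` are parallel and both place
`P` onto `π`; since `P ∉ π`, this forces them to coincide.

In the plane, the constraints either determine the fold line, or the image of a point on a line is a
root of a polynomial of degree at most three in its parameter. Where that polynomial can vanish
identically, there are infinitely many fold lines. -/

open scoped Matrix

noncomputable section

/-! ### Bézout inequalities for plane curves, complex and real -/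

namespace MvPolynomial

variable {K : Type*} [Field K]

/-- The number of monomials in two variables of total degree at most `k`. -/
theorem card_finsupp_fin_two_degree_le (k : ℕ) :
    Nat.card {n : Fin 2 →₀ ℕ | (n.sum fun _ e => e) ≤ k} * 2 = (k + 2) * (k + 1) := by
  have e : {n : Fin 2 →₀ ℕ | (n.sum fun _ e => e) ≤ k} ≃
      (Finset.range (k + 1)).sigma fun i => Finset.range (k + 1 - i) :=
    { toFun := fun n => ⟨⟨n.1 0, n.1 1⟩, by
        have := n.2
        simp only [Set.mem_ofPred_eq, Finsupp.sum_fintype, Fin.sum_univ_two, implies_true] at this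
        simp only [Finset.mem_sigma, Finset.mem_range]; omega⟩
      invFun := fun x => ⟨Finsupp.equivFunOnFinite.symm ![x.1.1, x.1.2], by
        have := x.2
        simp only [Finset.mem_sigma, Finset.mem_range] at this
        simp only [Set.mem_ofPred_eq, Finsupp.sum_fintype, Fin.sum_univ_two, implies_true]
        simp; omega⟩
      left_inv := fun n => by
        ext i; fin_cases i <;> simp
      right_inv := fun x => by simp }
  rw [Nat.card_congr e, Nat.card_eq_fintype_card, Fintype.card_coe, Finset.card_sigma]
  simp only [Finset.card_range]
  have h := Finset.sum_range_reflect (fun i => i + 1) (k + 1)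
  have h2 : ∑ i ∈ Finset.range (k + 1), (k + 1 - i) = ∑ i ∈ Finset.range (k + 1), (i + 1) := by
    rw [← h]; refine Finset.sum_congr rfl fun i hi => ?_
    have := Finset.mem_range.1 hi; omega
  rw [h2]
  clear h h2 e
  induction k with
  | zero => simp
  | succ k ih => rw [Finset.sum_range_succ, add_mul, ih]; ring

theorem finrank_restrictTotalDegree_fin_two (k : ℕ) :
    Module.finrank K (restrictTotalDegree (Fin 2) K k) * 2 = (k + 2) * (k + 1) := by
  rw [← card_finsupp_fin_two_degree_le k]
  congr 1
  exact Module.finrank_eq_nat_card_basis (basisRestrictSupport K _)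

instance finite_restrictTotalDegree_fin_two (k : ℕ) :
    Module.Finite K (restrictTotalDegree (Fin 2) K k) := by
  have : Module.finrank K (restrictTotalDegree (Fin 2) K k) ≠ 0 := by
    have := finrank_restrictTotalDegree_fin_two (K := K) k
    intro h; rw [h] at this; simp at this
  exact Module.finite_of_finrank_pos (Nat.pos_of_ne_zero this)

theorem finrank_map_mulLeft (f : MvPolynomial (Fin 2) K) (hf : f ≠ 0)
    (V : Submodule K (MvPolynomial (Fin 2) K)) :
    Module.finrank K (V.map (LinearMap.mulLeft K f)) = Module.finrank K V :=
  (Submodule.equivMapOfInjective _ (mul_right_injective₀ hf) V).symm.finrank_eq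

/-- Bézout's inequality in linear form: the quotient of `K[x, y]` by two relatively prime
polynomials has dimension at most the product of their degrees. -/
theorem finrank_le_totalDegree_mul_totalDegree {f g : MvPolynomial (Fin 2) K}
    (hf : f ≠ 0) (hg : g ≠ 0) (hfg : IsRelPrime f g) {W : Type*} [AddCommGroup W] [Module K W]
    [Module.Finite K W] (φ : MvPolynomial (Fin 2) K →ₗ[K] W) (hφ : Function.Surjective φ)
    (hφf : ∀ x, φ (f * x) = 0) (hφg : ∀ x, φ (g * x) = 0) :
    Module.finrank K W ≤ f.totalDegree * g.totalDegree := by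
  classical
  set m := f.totalDegree with hm
  set n := g.totalDegree with hn
  -- Since `W` is finite-dimensional, the polynomials of some bounded degree already surject onto
  -- it.
  obtain ⟨k, hk, hkmn⟩ : ∃ k, (restrictTotalDegree (Fin 2) K k).map φ = ⊤ ∧ m + n ≤ k := by
    let B := Module.finBasis K W
    choose p hp using fun i => hφ (B i)
    refine ⟨(Finset.univ.sup fun i => (p i).totalDegree) + (m + n), ?_, by omega⟩
    rw [eq_top_iff, ← B.span_eq, Submodule.span_le]
    rintro _ ⟨i, rfl⟩
    refine ⟨p i, ?_, hp i⟩
    rw [SetLike.mem_coe, mem_restrictTotalDegree]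
    exact (Finset.le_sup (f := fun i => (p i).totalDegree) (Finset.mem_univ i)).trans (by omega)
  obtain ⟨j, rfl⟩ := Nat.exists_eq_add_of_le hkmn
  let V := fun k => restrictTotalDegree (Fin 2) K k
  let I := (V (n + j)).map (LinearMap.mulLeft K f)
  let J := (V (m + j)).map (LinearMap.mulLeft K g)
  have hI : Module.finrank K I = Module.finrank K (V (n + j)) := finrank_map_mulLeft f hf _
  have hJ : Module.finrank K J = Module.finrank K (V (m + j)) := finrank_map_mulLeft g hg _
  -- If `f x = g y`, relative primality gives `g ∣ x`, so the intersection consists of multiples `f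
  -- g z` with `deg z ≤ j`.
  have hIJ : Module.finrank K ↑(I ⊓ J) ≤ Module.finrank K (V j) := by
    rw [← finrank_map_mulLeft (f * g) (mul_ne_zero hf hg) (V j)]
    refine Submodule.finrank_mono fun w hw => ?_
    obtain ⟨⟨x, hx, rfl⟩, ⟨y, hy, hxy⟩⟩ := hw
    simp only [LinearMap.mulLeft_apply] at hxy ⊢
    obtain ⟨z, rfl⟩ : g ∣ x := hfg.symm.dvd_of_dvd_mul_left ⟨y, hxy.symm⟩
    refine ⟨z, ?_, by simp⟩
    by_cases hz : z = 0
    · rw [hz]; exact Submodule.zero_mem _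
    simp only [V, SetLike.mem_coe, mem_restrictTotalDegree] at hx ⊢
    rw [totalDegree_mul_of_isDomain hg hz] at hx
    omega
  have hsup := Submodule.finrank_sup_add_finrank_inf_eq I J
  let ψ := φ.domRestrict (V (m + n + j))
  have hrange : LinearMap.range ψ = ⊤ := by
    rw [← hk, LinearMap.range_domRestrict]
  have hrk := LinearMap.finrank_range_add_finrank_ker ψ
  rw [hrange, finrank_top] at hrk
  have hle : I ⊔ J ≤ (LinearMap.ker ψ).map (V (m + n + j)).subtype := by
    refine sup_le ?_ ?_
    · rintro _ ⟨x, hx, rfl⟩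
      simp only [V, SetLike.mem_coe, mem_restrictTotalDegree] at hx
      refine ⟨⟨f * x, ?_⟩, ?_, rfl⟩
      · simp only [V, mem_restrictTotalDegree]
        exact (totalDegree_mul f x).trans (by omega)
      · simpa [ψ] using hφf x
    · rintro _ ⟨x, hx, rfl⟩
      simp only [V, SetLike.mem_coe, mem_restrictTotalDegree] at hx
      refine ⟨⟨g * x, ?_⟩, ?_, rfl⟩
      · simp only [V, mem_restrictTotalDegree]
        exact (totalDegree_mul g x).trans (by omega)
      · simpa [ψ] using hφg x
  have hker := (Submodule.finrank_mono hle).trans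
    (Submodule.finrank_map_le (V (m + n + j)).subtype (LinearMap.ker ψ))
  have h1 := finrank_restrictTotalDegree_fin_two (K := K) (m + n + j)
  have h2 := finrank_restrictTotalDegree_fin_two (K := K) (n + j)
  have h3 := finrank_restrictTotalDegree_fin_two (K := K) (m + j)
  have h4 := finrank_restrictTotalDegree_fin_two (K := K) j
  -- With `D k = (k + 2) (k + 1)`, twice the dimension in degree at most `k`, the bound is the
  -- identity `D (m + n + j) - D (n + j) - D (m + j) + D j = 2 m n`.
  simp only [V] at *
  zify at *
  nlinarith

/-- Finitely many points of `K²` impose independent conditions on polynomials. -/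
theorem exists_eval_eq (S : Finset (Fin 2 → K)) (y : (Fin 2 → K) → K) :
    ∃ p : MvPolynomial (Fin 2) K, ∀ s ∈ S, eval s p = y s := by
  classical
  induction S using Finset.induction_on with
  | empty => exact ⟨0, by simp⟩
  | insert s₀ S hs ih =>
    obtain ⟨p, hp⟩ := ih
    have hne : ∀ t ∈ S, ∃ i, s₀ i ≠ t i := fun t ht => by
      by_contra! h
      exact hs ((_root_.funext h : s₀ = t) ▸ ht)
    choose! i hi using hne
    let T : MvPolynomial (Fin 2) K := ∏ t ∈ S, (X (i t) - C (t (i t)))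
    have hT0 : eval s₀ T ≠ 0 := by
      simp only [T, map_prod, map_sub, eval_X, eval_C]
      exact Finset.prod_ne_zero_iff.2 fun t ht => sub_ne_zero.2 (hi t ht)
    have hT : ∀ t ∈ S, eval t T = 0 := fun t ht => by
      simp only [T, map_prod, map_sub, eval_X, eval_C]
      exact Finset.prod_eq_zero ht (sub_self _)
    refine ⟨p + C ((y s₀ - eval s₀ p) / eval s₀ T) * T, fun s h => ?_⟩
    rcases Finset.mem_insert.1 h with rfl | h
    · simp [hT0]
    · simp [hT s h, hp s h]

/-- Bézout's inequality for common zeros of relatively prime polynomials. -/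
theorem card_le_of_isRelPrime {f g : MvPolynomial (Fin 2) K} (hf : f ≠ 0) (hg : g ≠ 0)
    (hfg : IsRelPrime f g) (S : Finset (Fin 2 → K)) (hSf : ∀ s ∈ S, eval s f = 0)
    (hSg : ∀ s ∈ S, eval s g = 0) : S.card ≤ f.totalDegree * g.totalDegree := by
  have := finrank_le_totalDegree_mul_totalDegree hf hg hfg (W := S → K)
    (LinearMap.pi fun s : S => (aeval s.1 : MvPolynomial (Fin 2) K →ₐ[K] K).toLinearMap)
    (fun y => by
      classical
      obtain ⟨p, hp⟩ := exists_eval_eq S fun s => if h : s ∈ S then y ⟨s, h⟩ else 0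
      refine ⟨p, _root_.funext fun s => ?_⟩
      simpa [aeval_eq_eval] using hp s.1 s.2)
    (fun x => by ext s; simp [aeval_eq_eval, hSf s.1 s.2])
    (fun x => by ext s; simp [aeval_eq_eval, hSg s.1 s.2])
  simpa using this

/-- Bézout's inequality for real common zeros, improved by a pair of conjugate complex zeros. -/
theorem card_add_two_le_of_isRelPrime {f g : MvPolynomial (Fin 2) ℝ} (hf : f ≠ 0) (hg : g ≠ 0)
    (hfg : IsRelPrime f g) (S : Finset (Fin 2 → ℝ)) (hSf : ∀ s ∈ S, eval s f = 0)
    (hSg : ∀ s ∈ S, eval s g = 0) (z : Fin 2 → ℂ) {i : Fin 2} (hz : (z i).im ≠ 0)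
    (hzf : aeval z f = 0) (hzg : aeval z g = 0) :
    S.card + 2 ≤ f.totalDegree * g.totalDegree := by
  -- Evaluation at a non-real point takes values in `ℂ`, of real dimension two, so that point counts
  -- twice.
  have := finrank_le_totalDegree_mul_totalDegree hf hg hfg (W := (S → ℝ) × ℂ)
    ((LinearMap.pi fun s : S => (aeval s.1 : MvPolynomial (Fin 2) ℝ →ₐ[ℝ] ℝ).toLinearMap).prod
      (aeval z : MvPolynomial (Fin 2) ℝ →ₐ[ℝ] ℂ).toLinearMap)
    (fun y => by
      classical
      -- `M` is the real quadratic in one coordinate with roots `z i` and its conjugate: it vanishes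
      -- at `z` and at no real point. It serves to prescribe the values on `S` without affecting
      -- `z`.
      let M : MvPolynomial (Fin 2) ℝ := (X i - C (z i).re) ^ 2 + C ((z i).im ^ 2)
      have hM : ∀ s, eval s M ≠ 0 := fun s => by
        simp only [M, map_add, map_pow, map_sub, eval_X, eval_C]; positivity
      have hMz : aeval z M = 0 := by
        simp only [M, map_add, map_pow, map_sub, aeval_X, algHom_C, Complex.coe_algebraMap]
        have h : z i - ((z i).re : ℂ) = (z i).im * Complex.I := by
          rw [sub_eq_iff_eq_add, add_comm, Complex.re_add_im]
        rw [h, mul_pow, Complex.I_sq]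
        ring
      obtain ⟨p, hp⟩ := exists_eval_eq S fun s => if h : s ∈ S then y.1 ⟨s, h⟩ / eval s M else 0
      let T : MvPolynomial (Fin 2) ℝ := ∏ s ∈ S, (X i - C (s i))
      have hT : ∀ s ∈ S, eval s T = 0 := fun t ht => by
        simp only [T, map_prod, map_sub, eval_X, eval_C]
        exact Finset.prod_eq_zero ht (sub_self _)
      have hTz : aeval z T ≠ 0 := by
        simp only [T, map_prod, map_sub, aeval_X, algHom_C, Complex.coe_algebraMap]
        refine Finset.prod_ne_zero_iff.2 fun t _ h => hz ?_
        simpa using congrArg Complex.im h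
      let c := y.2 / aeval z T
      let u := c.im / (z i).im
      -- Since `z i` is not real, `1` and `z i` span `ℂ` over `ℝ`; a real linear polynomial can
      -- therefore take any value at `z`.
      have hc : (c.re - u * (z i).re : ℝ) + (u : ℂ) * z i = c := by
        apply Complex.ext <;> simp [u]
        field_simp
      refine ⟨p * M + T * (C (c.re - u * (z i).re) + C u * X i), Prod.ext (_root_.funext fun s => ?_) ?_⟩
      · simp [aeval_eq_eval, hp s.1 s.2, hT s.1 s.2, hM]
      · change aeval z (p * M + T * (C (c.re - u * (z i).re) + C u * X i)) = y.2
        rw [map_add, map_mul, hMz, mul_zero, zero_add, map_mul, map_add, map_mul, algHom_C,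
          algHom_C, aeval_X, Complex.coe_algebraMap, hc]
        simp only [c]; field_simp)
    (fun x => by ext s <;> simp [aeval_eq_eval, hSf, hzf])
    (fun x => by ext s <;> simp [aeval_eq_eval, hSg, hzg])
  simpa using this

/-- Over `ℂ`, a plane curve that meets the complement of another curve does so in infinitely
many points. -/
theorem zeros_eq_empty_of_finite {h l : MvPolynomial (Fin 2) ℂ} (hh : h ≠ 0)
    (hfin : {z | eval z h = 0 ∧ eval z l ≠ 0}.Finite) :
    {z | eval z h = 0 ∧ eval z l ≠ 0} = ∅ := by
  classical
  by_contra hne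
  obtain ⟨q, hq, hql⟩ := Set.nonempty_iff_ne_empty.2 hne
  obtain ⟨F, hF, u, hu⟩ := UniqueFactorizationMonoid.exists_prime_factors h hh
  obtain ⟨p, hpF, hpq⟩ : ∃ p ∈ F, eval q p = 0 := by
    rw [← hu, map_mul, mul_eq_zero, or_iff_left ((u.isUnit.map (eval q)).ne_zero),
      map_multiset_prod, Multiset.prod_eq_zero_iff, Multiset.mem_map] at hq
    exact hq
  have hp := hF p hpF
  have hph : p ∣ h := (Multiset.dvd_prod hpF).trans (Dvd.intro _ hu)
  -- By the Nullstellensatz `p` divides `l * T`, because `T` vanishes at the finitely many zeros of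
  -- `p` outside `l`. As `l` does not vanish at the zero `q` of `p`, the prime `p` divides a linear
  -- factor of `T`.
  have key : ∀ i : Fin 2, ∃ c, p ∣ X i - C c := by
    intro i
    let T : MvPolynomial (Fin 2) ℂ := ∏ t ∈ hfin.toFinset, (X i - C (t i))
    have hmem : l * T ∈ vanishingIdeal ℂ (zeroLocus ℂ (Ideal.span {p})) := by
      intro z hz
      have hpz : eval z p = 0 := by
        simpa [aeval_eq_eval] using hz p (Ideal.subset_span rfl)
      change eval z (l * T) = 0
      rw [map_mul]
      by_cases hl : eval z l = 0
      · simp [hl]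
      · have : eval z T = 0 := by
          simp only [T, map_prod, map_sub, eval_X, eval_C]
          refine Finset.prod_eq_zero (i := z) ?_ (sub_self _)
          obtain ⟨r, rfl⟩ := hph
          simp [hpz, hl]
        simp [this]
    have := (Ideal.span_singleton_prime hp.ne_zero).2 hp
    rw [IsPrime.vanishingIdeal_zeroLocus, Ideal.mem_span_singleton] at hmem
    rcases hp.dvd_or_dvd hmem with hl | hT
    · obtain ⟨r, rfl⟩ := hl
      simp [hpq] at hql
    · obtain ⟨t, -, ht⟩ := (hp.dvd_finsetProd_iff _).1 hT
      exact ⟨_, ht⟩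
  obtain ⟨c, a, ha⟩ := key 0
  obtain ⟨d, b, hb⟩ := key 1
  have hne : ∀ (i : Fin 2) (c : ℂ), (X i - C c : MvPolynomial (Fin 2) ℂ) ≠ 0 := fun i c h => by
    have := congrArg (eval fun _ => c + 1) h
    simp at this
  have hdeg : ∀ (i : Fin 2) (c : ℂ) (a : MvPolynomial (Fin 2) ℂ), X i - C c = p * a →
      ∃ k, k ≠ 0 ∧ a = C k := by
    intro i c a ha
    have ha0 : a ≠ 0 := by rintro rfl; exact hne i c (by simpa using ha)
    have h1 : (p * a).totalDegree ≤ 1 := by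
      rw [← ha]
      exact (totalDegree_sub_C_le _ _).trans (by simp)
    rw [totalDegree_mul_of_isDomain hp.ne_zero ha0] at h1
    have h2 : p.totalDegree ≠ 0 := fun h0 => by
      rw [totalDegree_eq_zero_iff_eq_C] at h0
      rw [h0, eval_C] at hpq
      exact hp.ne_zero (by rw [h0, hpq, C_0])
    have h3 : a.totalDegree = 0 := by omega
    rw [totalDegree_eq_zero_iff_eq_C] at h3
    exact ⟨_, fun h => ha0 (by rw [h3, h, C_0]), h3⟩
  obtain ⟨k, hk, rfl⟩ := hdeg 0 c a ha
  obtain ⟨m, hm, rfl⟩ := hdeg 1 d b hb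
  -- Up to constants `p` equals both `X 0 - C c` and `X 1 - C d`; at this point the first is
  -- non-zero and the second is zero.
  have h1 := congrArg (eval ![c + 1, d]) ha
  have h2 := congrArg (eval ![c + 1, d]) hb
  simp [hm] at h1 h2
  simp [h2] at h1

/-- Two complex plane curves with finitely many common points outside a third curve have at most
as many as the product of the bounds for their degrees. -/
theorem ncard_common_zeros_le {f g l : MvPolynomial (Fin 2) ℂ} {m n : ℕ}
    (hfm : f.totalDegree ≤ m) (hgn : g.totalDegree ≤ n)
    (hfin : {z | eval z f = 0 ∧ eval z g = 0 ∧ eval z l ≠ 0}.Finite) :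
    {z | eval z f = 0 ∧ eval z g = 0 ∧ eval z l ≠ 0}.ncard ≤ m * n := by
  classical
  suffices H : ∀ {f g : MvPolynomial (Fin 2) ℂ} {m n : ℕ}, f ≠ 0 → f.totalDegree ≤ m →
      g.totalDegree ≤ n → {z | eval z f = 0 ∧ eval z g = 0 ∧ eval z l ≠ 0}.Finite →
      {z | eval z f = 0 ∧ eval z g = 0 ∧ eval z l ≠ 0}.ncard ≤ m * n by
    by_cases hf : f = 0
    · by_cases hg : g = 0
      · subst hf hg
        have h1 : {z : Fin 2 → ℂ | eval z (0 : MvPolynomial (Fin 2) ℂ) = 0 ∧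
            eval z (0 : MvPolynomial (Fin 2) ℂ) = 0 ∧ eval z l ≠ 0} =
            {z | eval z (X 0 * 0 : MvPolynomial (Fin 2) ℂ) = 0 ∧ eval z l ≠ 0} := by ext; simp
        rw [Set.ncard_eq_zero hfin |>.2]
        · exact Nat.zero_le _
        · by_contra hne
          obtain ⟨q, -, -, hq⟩ := Set.nonempty_iff_ne_empty.2 hne
          -- If both polynomials vanish identically, the set contains all points outside `l` of a
          -- line through `q`, which cannot be finitely many.
          have := zeros_eq_empty_of_finite (h := X 0 - C (q 0)) (l := l)
            (fun h => by
              have := congrArg (eval fun _ => q 0 + 1) h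
              simp at this)
            (hfin.subset fun z hz => ⟨map_zero _, map_zero _, hz.2⟩)
          exact Set.eq_empty_iff_forall_notMem.1 this q ⟨by simp, hq⟩
      · have := H hg hgn hfm (hfin.subset fun z hz => ⟨hz.2.1, hz.1, hz.2.2⟩)
        rw [mul_comm]
        convert this using 2
        ext; simp only [Set.mem_ofPred_eq]; tauto
    · exact H hf hfm hgn hfin
  clear! f g m n
  intro f g m n hf hfm hgn hfin
  obtain ⟨f', g', h, hrel, rfl, rfl⟩ := UniqueFactorizationMonoid.exists_reduced_factors f hf g
  have hh : h ≠ 0 := left_ne_zero_of_mul hf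
  have hf' : f' ≠ 0 := right_ne_zero_of_mul hf
  -- Zeros of the common factor `h` outside `l` are common zeros, hence finite in number, hence
  -- absent.
  have hempty := zeros_eq_empty_of_finite (l := l) hh
    (hfin.subset fun z hz => ⟨by simp [hz.1], by simp [hz.1], hz.2⟩)
  have hz : ∀ z ∈ hfin.toFinset, eval z f' = 0 ∧ eval z g' = 0 := by
    intro z hz
    obtain ⟨h1, h2, h3⟩ := hfin.mem_toFinset.1 hz
    have hhz : eval z h ≠ 0 := fun h0 =>
      Set.eq_empty_iff_forall_notMem.1 hempty z ⟨h0, h3⟩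
    exact ⟨by simpa [hhz] using h1, by simpa [hhz] using h2⟩
  rw [Set.ncard_eq_toFinset_card _ hfin]
  by_cases hg' : g' = 0
  · subst hg'
    have hu : IsUnit f' := hrel dvd_rfl (dvd_zero _)
    rw [Finset.card_eq_zero.2]
    · exact Nat.zero_le _
    · exact Finset.eq_empty_of_forall_notMem fun z h => (hu.map (eval z)).ne_zero (hz z h).1
  refine (card_le_of_isRelPrime hf' hg' hrel _ (fun z h => (hz z h).1) fun z h => (hz z h).2).trans
    (Nat.mul_le_mul ?_ ?_)
  · exact (totalDegree_le_of_dvd_of_isDomain (Dvd.intro_left _ rfl) hf).trans hfm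
  · exact (totalDegree_le_of_dvd_of_isDomain (Dvd.intro_left _ rfl) (mul_ne_zero hh hg')).trans hgn

/-- Identifies formal partial derivatives with the analytic differential, so that the open mapping
argument at regular points applies. -/
theorem hasStrictFDerivAt_eval (p : MvPolynomial (Fin 2) ℝ) (q : Fin 2 → ℝ) :
    HasStrictFDerivAt (fun x => eval x p)
      (∑ i, eval q (pderiv i p) • ContinuousLinearMap.proj (R := ℝ) (φ := fun _ : Fin 2 => ℝ) i)
      q := by
  induction p using MvPolynomial.induction_on with
  | C a =>
    simp only [eval_C, pderiv_C, map_zero, zero_smul, Finset.sum_const_zero]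
    exact hasStrictFDerivAt_const _ _
  | add p r hp hr =>
    simp only [map_add, add_smul, Finset.sum_add_distrib]
    exact hp.add hr
  | mul_X p j hp =>
    have hj : HasStrictFDerivAt (fun x : Fin 2 → ℝ => x j)
        (ContinuousLinearMap.proj (R := ℝ) (φ := fun _ : Fin 2 => ℝ) j) q :=
      (ContinuousLinearMap.proj (R := ℝ) (φ := fun _ : Fin 2 => ℝ) j).hasStrictFDerivAt
    simp only [map_mul, eval_X]
    refine (hp.mul hj).congr_fderiv ?_
    ext v
    fin_cases j <;> simp [pderiv_X, Pi.single_apply] <;> ring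

/-- A regular real point of a plane curve is not isolated. -/
theorem infinite_zeros_of_pderiv_ne_zero {p l : MvPolynomial (Fin 2) ℝ} {q : Fin 2 → ℝ}
    (hp : eval q p = 0) (hl : eval q l ≠ 0) {i : Fin 2} (hi : eval q (pderiv i p) ≠ 0) :
    {x | eval x p = 0 ∧ eval x l ≠ 0}.Infinite := by
  obtain ⟨j, hij⟩ : ∃ j, j ≠ i := exists_ne i
  let π : ∀ k : Fin 2, (Fin 2 → ℝ) →L[ℝ] ℝ :=
    fun k => ContinuousLinearMap.proj (R := ℝ) (φ := fun _ : Fin 2 => ℝ) k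
  -- The map `x ↦ (p x, x j)` is a submersion at `q`, so it sends neighbourhoods to neighbourhoods.
  -- The image of the complement of `l` thus contains `(0, s)` for all `s` near `q j`.
  have hF := (hasStrictFDerivAt_eval p q).prodMk (π j).hasStrictFDerivAt
  have hsurj : (((∑ k, eval q (pderiv k p) • π k).prod (π j)) :
      (Fin 2 → ℝ) →L[ℝ] ℝ × ℝ).range = ⊤ := by
    rw [LinearMap.range_eq_top]
    rintro ⟨a, b⟩
    refine ⟨Function.update (fun _ => b) i
      ((a - eval q (pderiv j p) * b) / eval q (pderiv i p)), Prod.ext ?_ ?_⟩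
    · fin_cases i <;> fin_cases j <;> simp_all [π] <;> field_simp <;> ring
    · simp [π, hij]
  have hmap := hF.map_nhds_eq_of_surj hsurj
  have hU : {x | eval x l ≠ 0} ∈ nhds q :=
    (isOpen_ne_fun (continuous_eval l) continuous_const).mem_nhds hl
  have hV := Filter.image_mem_map (m := fun x => (eval x p, π j x)) hU
  rw [hmap] at hV
  have hW : (fun s : ℝ => ((0 : ℝ), s)) ⁻¹' ((fun x => (eval x p, π j x)) '' {x | eval x l ≠ 0}) ∈
      nhds (q j) := by
    refine (Continuous.prodMk continuous_const continuous_id).continuousAt.preimage_mem_nhds ?_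
    simpa [π, hp] using hV
  intro hfin
  refine infinite_of_mem_nhds (q j) hW ((hfin.image fun x => x j).subset ?_)
  rintro s ⟨x, hx, hxs⟩
  simp only [Prod.mk.injEq] at hxs
  exact ⟨x, ⟨hxs.1, hx⟩, hxs.2⟩

theorem totalDegree_pderiv_lt {p : MvPolynomial (Fin 2) ℝ} (i : Fin 2) (hp : pderiv i p ≠ 0) :
    (pderiv i p).totalDegree < p.totalDegree := by
  have h : ∀ m ∈ (pderiv i p).support, (m.sum fun _ e => e) < p.totalDegree := fun m hm => by
    rw [mem_support_iff, coeff_pderiv] at hm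
    have := le_totalDegree (mem_support_iff.2 (left_ne_zero_of_mul hm))
    rw [Finsupp.sum_add_index' (by simp) (by simp)] at this
    simp at this
    omega
  obtain ⟨m, hm⟩ := support_nonempty.2 hp
  exact (Finset.sup_lt_iff (bot_le.trans_lt (h m hm))).2 h

theorem exists_pderiv_ne_zero {p : MvPolynomial (Fin 2) ℝ} (hp : p.totalDegree ≠ 0) :
    ∃ i, pderiv i p ≠ 0 := by
  by_contra! h
  apply hp
  rw [totalDegree_eq_zero_iff]
  intro m hm i
  by_contra hi
  have h1 := congrArg (coeff (m - Finsupp.single i 1)) (h i)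
  have h2 : m - Finsupp.single i 1 + Finsupp.single i 1 = m :=
    tsub_add_cancel_of_le (by simpa using Nat.one_le_iff_ne_zero.2 hi)
  rw [coeff_pderiv, h2, coeff_zero, mul_eq_zero] at h1
  rcases h1 with h1 | h1
  · exact (mem_support_iff.1 hm) h1
  · exact absurd h1 (by positivity)

/-- A real plane curve of degree `d` has at most `d (d - 1)` points outside another curve if their
number is finite. -/
theorem ncard_real_zeros_le {h l : MvPolynomial (Fin 2) ℝ} (hh : h ≠ 0)
    (hfin : {x | eval x h = 0 ∧ eval x l ≠ 0}.Finite) :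
    {x | eval x h = 0 ∧ eval x l ≠ 0}.ncard ≤ h.totalDegree * (h.totalDegree - 1) := by
  induction h using UniqueFactorizationMonoid.induction_on_prime with
  | h₁ => exact absurd rfl hh
  | h₂ u hu =>
    rw [(Set.ncard_eq_zero hfin).2]
    · exact Nat.zero_le _
    · exact Set.eq_empty_iff_forall_notMem.2 fun x hx => (hu.map (eval x)).ne_zero hx.1
  | h₃ a p ha hp ih =>
    have hsplit : {x | eval x (p * a) = 0 ∧ eval x l ≠ 0} =
        {x | eval x p = 0 ∧ eval x l ≠ 0} ∪ {x | eval x a = 0 ∧ eval x l ≠ 0} := by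
      ext x; simp only [map_mul, mul_eq_zero, Set.mem_ofPred_eq, Set.mem_union]; tauto
    have hfinp := hfin.subset (hsplit ▸ Set.subset_union_left)
    have hfina := hfin.subset (hsplit ▸ Set.subset_union_right)
    have hp1 : {x | eval x p = 0 ∧ eval x l ≠ 0}.ncard ≤ p.totalDegree * (p.totalDegree - 1) := by
      by_cases hdeg : p.totalDegree = 0
      · rw [(Set.ncard_eq_zero hfinp).2]
        · exact Nat.zero_le _
        · refine Set.eq_empty_iff_forall_notMem.2 fun x hx => hp.ne_zero ?_
          have := totalDegree_eq_zero_iff_eq_C.1 hdeg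
          have hx0 := hx.1
          rw [this, eval_C] at hx0
          rw [this, hx0, C_0]
      obtain ⟨i, hi⟩ := exists_pderiv_ne_zero hdeg
      have hlt := totalDegree_pderiv_lt i hi
      -- A regular zero would make the set infinite, so every zero of `p` outside `l` is also a zero
      -- of `pderiv i p`. That derivative has smaller degree, hence is prime to `p`, and Bézout
      -- applies.
      have hrel : IsRelPrime p (pderiv i p) :=
        (hp.irreducible.isRelPrime_iff_not_dvd).2 fun hdvd =>
          (totalDegree_le_of_dvd_of_isDomain hdvd hi).not_gt hlt
      rw [Set.ncard_eq_toFinset_card _ hfinp]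
      refine (card_le_of_isRelPrime hp.ne_zero hi hrel _ (fun x hx => ?_) fun x hx => ?_).trans
        (Nat.mul_le_mul_left _ (by omega))
      · exact (hfinp.mem_toFinset.1 hx).1
      · by_contra hne
        obtain ⟨h1, h2⟩ := hfinp.mem_toFinset.1 hx
        exact infinite_zeros_of_pderiv_ne_zero h1 h2 hne hfinp
    have ha1 := ih ha hfina
    rw [hsplit, totalDegree_mul_of_isDomain hp.ne_zero ha]
    refine (Set.ncard_union_le _ _).trans ((Nat.add_le_add hp1 ha1).trans ?_)
    -- The function `d (d - 1)` is superadditive; degree zero is separated because of the truncated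
    -- subtraction.
    rcases Nat.eq_zero_or_pos p.totalDegree with h1 | h1
    · simp [h1]
    rcases Nat.eq_zero_or_pos a.totalDegree with h2 | h2
    · simp [h2]
    obtain ⟨u, hu⟩ := Nat.exists_eq_add_of_le h1
    obtain ⟨v, hv⟩ := Nat.exists_eq_add_of_le h2
    rw [hu, hv, show 1 + u - 1 = u by omega, show 1 + v - 1 = v by omega,
      show 1 + u + (1 + v) - 1 = u + v + 1 by omega]
    nlinarith

/-- Two real plane cubics with finitely many common points outside a third curve have at most seven
of them, if one of the cubics is a conic or if there is a non-real common point. -/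
theorem ncard_common_real_zeros_le_seven {f g l : MvPolynomial (Fin 2) ℝ}
    (hf3 : f.totalDegree ≤ 3) (hg3 : g.totalDegree ≤ 3)
    (hcase : f.totalDegree ≤ 2 ∨ g.totalDegree ≤ 2 ∨
      ∃ (z : Fin 2 → ℂ) (i : Fin 2), (z i).im ≠ 0 ∧ aeval z f = 0 ∧ aeval z g = 0)
    (hfin : {x | eval x f = 0 ∧ eval x g = 0 ∧ eval x l ≠ 0}.Finite) :
    {x | eval x f = 0 ∧ eval x g = 0 ∧ eval x l ≠ 0}.ncard ≤ 7 := by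
  classical
  suffices H : ∀ {f g : MvPolynomial (Fin 2) ℝ}, f ≠ 0 → f.totalDegree ≤ 3 →
      g.totalDegree ≤ 3 → (f.totalDegree ≤ 2 ∨ g.totalDegree ≤ 2 ∨
        ∃ (z : Fin 2 → ℂ) (i : Fin 2), (z i).im ≠ 0 ∧ aeval z f = 0 ∧ aeval z g = 0) →
      {z | eval z f = 0 ∧ eval z g = 0 ∧ eval z l ≠ 0}.Finite →
      {z | eval z f = 0 ∧ eval z g = 0 ∧ eval z l ≠ 0}.ncard ≤ 7 by
    by_cases hf : f = 0
    · by_cases hg : g = 0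
      · subst hf hg
        rw [Set.ncard_eq_zero hfin |>.2]
        · exact Nat.zero_le _
        · by_contra hne
          obtain ⟨q, -, -, hq⟩ := Set.nonempty_iff_ne_empty.2 hne
          refine infinite_zeros_of_pderiv_ne_zero (p := X 0 - C (q 0)) (l := l) (q := q) (i := 0)
            (by simp) hq (by simp) (hfin.subset fun z hz => ⟨map_zero _, map_zero _, hz.2⟩)
      · have := H hg hg3 hf3 (by
          rcases hcase with h | h | ⟨z, i, h1, h2, h3⟩
          exacts [.inr (.inl h), .inl h, .inr (.inr ⟨z, i, h1, h3, h2⟩)])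
          (hfin.subset fun z hz => ⟨hz.2.1, hz.1, hz.2.2⟩)
        convert this using 2
        ext; simp only [Set.mem_ofPred_eq]; tauto
    · exact H hf hf3 hg3 hcase hfin
  clear! f g
  intro f g hf hf3 hg3 hcase hfin
  obtain ⟨f', g', h, hrel, rfl, rfl⟩ := UniqueFactorizationMonoid.exists_reduced_factors f hf g
  have hh : h ≠ 0 := left_ne_zero_of_mul hf
  have hf' : f' ≠ 0 := right_ne_zero_of_mul hf
  have hfin1 : {x | eval x h = 0 ∧ eval x l ≠ 0}.Finite :=
    hfin.subset fun z hz => ⟨by simp [hz.1], by simp [hz.1], hz.2⟩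
  have hfin2 : {x | eval x f' = 0 ∧ eval x g' = 0 ∧ eval x l ≠ 0}.Finite :=
    hfin.subset fun z hz => ⟨by simp [hz.1], by simp [hz.2.1], hz.2.2⟩
  have h1 := ncard_real_zeros_le hh hfin1
  have hsub : {x | eval x (h * f') = 0 ∧ eval x (h * g') = 0 ∧ eval x l ≠ 0} ⊆
      {x | eval x h = 0 ∧ eval x l ≠ 0} ∪ {x | eval x f' = 0 ∧ eval x g' = 0 ∧ eval x l ≠ 0} := by
    intro x hx
    simp only [map_mul, mul_eq_zero, Set.mem_ofPred_eq, Set.mem_union] at hx ⊢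
    tauto
  have hle := (Set.ncard_le_ncard hsub (hfin1.union hfin2)).trans (Set.ncard_union_le _ _)
  -- With `k = deg h`, the common factor contributes at most `k (k - 1)` points and the reduced pair
  -- at most `(3 - k)²`. Only `k = 0` needs the extra assumption.
  refine hle.trans ?_
  have hdegf := totalDegree_mul_of_isDomain hh hf'
  rw [hdegf] at hf3
  have hd : h.totalDegree ≤ 3 := by omega
  by_cases hg' : g' = 0
  · subst hg'
    have hu : IsUnit f' := hrel dvd_rfl (dvd_zero _)
    have h2 : {x | eval x f' = 0 ∧ eval x (0 : MvPolynomial (Fin 2) ℝ) = 0 ∧ eval x l ≠ 0} = ∅ :=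
      Set.eq_empty_iff_forall_notMem.2 fun z h => (hu.map (eval z)).ne_zero h.1
    rw [h2, Set.ncard_empty]
    interval_cases h.totalDegree <;> omega
  have hdegg := totalDegree_mul_of_isDomain hh hg'
  rw [hdegf, hdegg] at hcase
  rw [hdegg] at hg3
  rw [Set.ncard_eq_toFinset_card _ hfin2]
  have hz : ∀ x ∈ hfin2.toFinset, eval x f' = 0 ∧ eval x g' = 0 ∧ eval x l ≠ 0 :=
    fun x hx => hfin2.mem_toFinset.1 hx
  have h2 := card_le_of_isRelPrime hf' hg' hrel _ (fun z h => (hz z h).1) fun z h => (hz z h).2.1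
  rcases Nat.eq_zero_or_pos h.totalDegree with h0 | hpos
  · rw [h0] at h1 hf3 hg3 hcase
    rw [zero_mul, Nat.le_zero] at h1
    rw [h1, zero_add]
    rw [zero_add] at hf3 hg3
    simp only [zero_add] at hcase
    rcases hcase with h3 | h3 | ⟨z, i, hi, h3, h4⟩
    · exact h2.trans ((Nat.mul_le_mul h3 hg3).trans (by norm_num))
    · exact h2.trans ((Nat.mul_le_mul hf3 h3).trans (by norm_num))
    -- Here `h` is a non-zero constant, so the non-real point survives as a common zero of `f'` and
    -- `g'`.
    · have hhz : aeval z h ≠ 0 := by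
        have hC := totalDegree_eq_zero_iff_eq_C.1 h0
        rw [hC, algHom_C, Complex.coe_algebraMap]
        exact_mod_cast fun h => hh (by rw [hC, h, C_0])
      have h5 := card_add_two_le_of_isRelPrime hf' hg' hrel _ (fun z h => (hz z h).1)
        (fun z h => (hz z h).2.1) z hi (by simpa [hhz] using h3) (by simpa [hhz] using h4)
      have := h5.trans (Nat.mul_le_mul hf3 hg3)
      omega
  · have h3 := h2.trans (Nat.mul_le_mul (show f'.totalDegree ≤ 3 - h.totalDegree by omega)
      (show g'.totalDegree ≤ 3 - h.totalDegree by omega))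
    interval_cases h.totalDegree <;> omega

end MvPolynomial

/-! ### Reflections, and fold planes as real solutions -/

namespace Origami

open AffineSubspace

local notation "⟪" x ", " y "⟫" => inner ℝ x y

theorem Hyperplane.ext_val {k : ℕ} {Δ Δ' : Hyperplane k} (h : Δ.1 = Δ'.1) : Δ = Δ' :=
  Subtype.ext h

theorem Hyperplane.exists_normal {k : ℕ} (Δ : Hyperplane k) :
    ∃ (n : E k) (t : ℝ), n ≠ 0 ∧ ∀ x, x ∈ Δ.points ↔ ⟪n, x⟫ = t := by
  obtain ⟨x₀, hx₀⟩ := Δ.2.1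
  have h1 : Module.finrank ℝ (Δ.1.directionᗮ : Submodule ℝ (E k)) = 1 := by
    have := Submodule.finrank_add_finrank_orthogonal Δ.1.direction
    rw [finrank_euclideanSpace_fin] at this
    have := Δ.2.2
    omega
  obtain ⟨⟨n, hn⟩, hn0, hspan⟩ := finrank_eq_one_iff'.1 h1
  refine ⟨n, ⟪n, x₀⟫, fun h => hn0 (Subtype.ext h), fun x => ?_⟩
  have h2 : x ∈ Δ.points ↔ x - x₀ ∈ Δ.1.direction :=
    (vsub_right_mem_direction_iff_mem hx₀ x).symm
  rw [h2, ← sub_eq_zero, ← inner_sub_right]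
  constructor
  · intro h
    exact Submodule.inner_left_of_mem_orthogonal h hn
  · intro h
    rw [← Submodule.orthogonal_orthogonal Δ.1.direction, Submodule.mem_orthogonal]
    intro u hu
    obtain ⟨c, hc⟩ := hspan ⟨u, hu⟩
    have : u = c • n := (congrArg Subtype.val hc).symm
    rw [this, inner_smul_left, h, mul_zero]

theorem fold_eq_of_normal {k : ℕ} {Δ : Hyperplane k} {n : E k} {t : ℝ} (hn : n ≠ 0)
    (h : ∀ x, x ∈ Δ.points ↔ ⟪n, x⟫ = t) (X : E k) :
    fold Δ X = X - (2 * (⟪n, X⟫ - t) / ⟪n, n⟫) • n := by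
  have hnn : ⟪n, n⟫ ≠ 0 := inner_self_ne_zero.2 hn
  have : Nonempty Δ.1 := Δ.2.1.to_subtype
  set r := (⟪n, X⟫ - t) / ⟪n, n⟫ with hr
  have hp : X - r • n ∈ Δ.1 := (h _).2 (by
    rw [inner_sub_right, inner_smul_right, hr]; field_simp; ring)
  have hv : r • n ∈ Δ.1.directionᗮ := by
    refine Submodule.smul_mem _ _ ((Submodule.mem_orthogonal' _ _).2 fun u hu => ?_)
    have h1 : u + (X - r • n) ∈ Δ.1 := vadd_mem_of_mem_direction hu hp
    have h2 := (h _).1 h1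
    rw [inner_add_right, (h _).1 hp] at h2
    linarith
  have := EuclideanGeometry.reflection_orthogonal_vadd hp hv
  simp only [vadd_eq_add, add_sub_cancel] at this
  rw [fold, this, mul_div_assoc, ← hr, mul_smul, two_smul]
  abel

theorem fold_eq_self_iff {k : ℕ} {Δ : Hyperplane k} {X : E k} :
    fold Δ X = X ↔ X ∈ Δ.points := by
  have : Nonempty Δ.1 := Δ.2.1.to_subtype
  exact EuclideanGeometry.reflection_eq_self_iff X

/-- The perpendicular bisector of two distinct points. -/
def perpHyperplane {k : ℕ} (X Y : E k) (h : X ≠ Y) : Hyperplane k :=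
  ⟨perpBisector X Y, perpBisector_nonempty, by
    rw [direction_perpBisector]
    have h1 := Submodule.finrank_add_finrank_orthogonal (Submodule.span ℝ {Y -ᵥ X})
    rw [finrank_span_singleton (vsub_ne_zero.2 h.symm), finrank_euclideanSpace_fin] at h1
    omega⟩

theorem mem_perpHyperplane {k : ℕ} {X Y : E k} (h : X ≠ Y) (x : E k) :
    x ∈ (perpHyperplane X Y h).points ↔ ⟪Y - X, x⟫ = (⟪Y, Y⟫ - ⟪X, X⟫) / 2 := by
  change x ∈ perpBisector X Y ↔ _
  rw [mem_perpBisector_iff_inner_eq_inner]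
  simp only [vsub_eq_sub, inner_sub_left, inner_sub_right, real_inner_comm x, real_inner_comm Y X]
  constructor <;> intro h <;> linarith

theorem fold_perpHyperplane {k : ℕ} {X Y : E k} (h : X ≠ Y) (Z : E k) :
    fold (perpHyperplane X Y h) Z =
      Z - ((2 * ⟪Y - X, Z⟫ - (⟪Y, Y⟫ - ⟪X, X⟫)) / ⟪Y - X, Y - X⟫) • (Y - X) := by
  rw [fold_eq_of_normal (sub_ne_zero.2 h.symm) (mem_perpHyperplane h)]
  congr 3
  ring

theorem fold_perpHyperplane_left {k : ℕ} {X Y : E k} (h : X ≠ Y) :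
    fold (perpHyperplane X Y h) X = Y := by
  have hnn : ⟪Y - X, Y - X⟫ ≠ 0 := inner_self_ne_zero.2 (sub_ne_zero.2 h.symm)
  have : (2 * ⟪Y - X, X⟫ - (⟪Y, Y⟫ - ⟪X, X⟫)) / ⟪Y - X, Y - X⟫ = -1 := by
    rw [div_eq_iff hnn]
    simp only [inner_sub_left, inner_sub_right, real_inner_comm Y X]; ring
  rw [fold_perpHyperplane, this, neg_one_smul]
  abel

/-- The points of `Δ` are fixed by an isometry that takes `X` to `Y`, so they are equidistant from
both. Thus `Δ` lies in the bisector, and the dimensions agree. -/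
theorem eq_perpHyperplane {k : ℕ} {Δ : Hyperplane k} {X Y : E k} (hXY : fold Δ X = Y)
    (h : X ≠ Y) : Δ = perpHyperplane X Y h := by
  have hle : Δ.1 ≤ perpBisector X Y := by
    intro x hx
    have : Nonempty Δ.1 := Δ.2.1.to_subtype
    have hx' : fold Δ x = x := fold_eq_self_iff.2 hx
    rw [mem_perpBisector_iff_dist_eq, ← hXY]
    conv_rhs => rw [← hx']
    exact ((EuclideanGeometry.reflection Δ.1).dist_map x X).symm
  refine Hyperplane.ext_val (eq_of_direction_eq_of_nonempty_of_le ?_ Δ.2.1 hle)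
  refine Submodule.eq_of_le_of_finrank_eq (direction_le hle) ?_
  have h1 := Δ.2.2
  have h2 := (perpHyperplane X Y h).2.2
  change Module.finrank ℝ (perpBisector X Y).direction + 1 = k at h2
  change _ = Module.finrank ℝ (perpBisector X Y).direction
  omega

/-- Two folds that move the point `P` onto the same point agree. -/
theorem eq_of_fold_eq {k : ℕ} {Δ Δ' : Hyperplane k} {P : E k} (h : fold Δ P = fold Δ' P)
    (hP : fold Δ P ≠ P) : Δ = Δ' := by
  rw [eq_perpHyperplane rfl hP.symm, eq_perpHyperplane h.symm hP.symm]

/-- Two folds in parallel hyperplanes that both place `P` onto the hyperplane `π` agree. -/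
theorem eq_of_fold_mem {k : ℕ} {π Δ Δ' : Hyperplane k} {P a w : E k} {d : ℝ}
    (hπ : ∀ x, x ∈ π.points ↔ ⟪a, x⟫ + d = 0)
    (hP : P ∉ π.points) (h : fold Δ P ∈ π.points) (h' : fold Δ' P ∈ π.points)
    {r r' : ℝ} (hr : fold Δ P = P + r • w) (hr' : fold Δ' P = P + r' • w) : Δ = Δ' := by
  refine eq_of_fold_eq (P := P) ?_ fun h0 => hP (h0 ▸ h)
  rw [hr, hπ, inner_add_right, inner_smul_right] at h
  rw [hr', hπ, inner_add_right, inner_smul_right] at h'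
  rw [hπ] at hP
  -- The line through `P` in direction `w` meets `π` but is not contained in it, so it meets `π`
  -- only once.
  have haw : ⟪a, w⟫ ≠ 0 := fun h0 => hP (by rw [h0] at h; linarith)
  have : r = r' := mul_right_cancel₀ haw (by linarith)
  rw [hr, hr', this]

theorem toComplex_injective : Function.Injective toComplex := fun x y h => by
  ext i
  exact Complex.ofReal_injective (congrFun h i)

theorem toComplex_dotProduct (x y : E 3) : toComplex x ⬝ᵥ toComplex y = (⟪x, y⟫ : ℝ) := by
  simp only [toComplex, dotProduct, Fin.sum_univ_three, PiLp.inner_apply, RCLike.inner_apply,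
    conj_trivial]
  push_cast
  ring

theorem toComplex_sub (x y : E 3) : toComplex (x - y) = toComplex x - toComplex y := by
  ext i; simp [toComplex]

theorem toComplex_smul (r : ℝ) (x : E 3) : toComplex (r • x) = (r : ℂ) • toComplex x := by
  ext i; simp [toComplex]

theorem foldEquation_toComplex_iff (P a : E 3) (d : ℝ) (X Y : E 3) :
    FoldEquation P a d (toComplex X) (toComplex Y) ↔
      ⟪a, Y - X⟫ * (⟪Y, Y⟫ - ⟪X, X⟫) =
        2 * ⟪P, Y - X⟫ * ⟪a, Y - X⟫ - (⟪a, P⟫ + d) * ⟪Y - X, Y - X⟫ := by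
  simp only [FoldEquation, ← toComplex_sub, toComplex_dotProduct]
  norm_cast

/-- Real solutions of the fold equation between distinct points describe folds of `P` onto `π`. -/
theorem foldEquation_iff_fold_mem {π : Hyperplane 3} {P a : E 3} {d : ℝ} (hπ : HasEquation π a d)
    {X Y : E 3} (h : X ≠ Y) :
    FoldEquation P a d (toComplex X) (toComplex Y) ↔
      fold (perpHyperplane X Y h) P ∈ π.points := by
  have hnn : ⟪Y - X, Y - X⟫ ≠ 0 := inner_self_ne_zero.2 (sub_ne_zero.2 h.symm)
  rw [foldEquation_toComplex_iff, hπ, fold_perpHyperplane, inner_sub_right a P, inner_smul_right,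
    real_inner_comm P (Y - X)]
  constructor
  · intro H; field_simp; linarith
  · intro H; field_simp at H; linarith

theorem IsRealSolution.exists_eq {s : ℂ × (Fin 3 → ℂ) × (Fin 3 → ℂ)} (h : IsRealSolution s) :
    ∃ (l : ℝ) (Y Z : E 3), s = ((l : ℂ), toComplex Y, toComplex Z) := by
  obtain ⟨h1, h2, h3⟩ := h
  refine ⟨s.1.re, WithLp.toLp 2 fun i => (s.2.1 i).re, WithLp.toLp 2 fun i => (s.2.2 i).re,
    Prod.ext ?_ (Prod.ext (funext fun i => ?_) (funext fun i => ?_))⟩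
  · exact Complex.ext rfl (by simpa using h1)
  · exact Complex.ext rfl (by simpa [toComplex] using h2 i)
  · exact Complex.ext rfl (by simpa [toComplex] using h3 i)

theorem isRealSolution_mk (l : ℝ) (Y Z : E 3) :
    IsRealSolution ((l : ℂ), toComplex Y, toComplex Z) := by
  simp [IsRealSolution, toComplex]

theorem solutionPlane_mk (Q : E 3) (l : ℂ) (Y : E 3) (Z : Fin 3 → ℂ) :
    solutionPlane Q (l, toComplex Y, Z) = perpBisector Q Y := by
  simp [solutionPlane, toComplex]

theorem toComplex_dotProduct_add_eq_zero_iff {π : Hyperplane 3} {a : E 3} {d : ℝ}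
    (hπ : HasEquation π a d) (X : E 3) :
    toComplex a ⬝ᵥ toComplex X + d = 0 ↔ X ∈ π.points := by
  rw [hπ, toComplex_dotProduct]
  norm_cast

section Bijection

variable {P Q R : E 3} {π τ ρ : Hyperplane 3} {a b c : E 3} {d e f : ℝ}

/-- A real solution consists of the images of `Q` and `R` under the fold in its plane. -/
theorem exists_fold_of_mem_complexSolutions
    (hP : P ∉ π.points) (hQ : Q ∉ τ.points) (hR : R ∉ ρ.points)
    (hπ : HasEquation π a d) (hτ : HasEquation τ b e) (hρ : HasEquation ρ c f)
    {s : ℂ × (Fin 3 → ℂ) × (Fin 3 → ℂ)} (hs : s ∈ complexSolutions P Q R a b c d e f)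
    (hreal : IsRealSolution s) :
    ∃ Δ ∈ foldPlanes P Q R π τ ρ, Δ.1 = solutionPlane Q s ∧
      s.2.1 = toComplex (fold Δ Q) ∧ s.2.2 = toComplex (fold Δ R) := by
  obtain ⟨l, Y, Z, rfl⟩ := hreal.exists_eq
  obtain ⟨h1, h2, h3, h4, h5⟩ := hs
  simp only at h1 h2 h3 h4 h5
  rw [toComplex_dotProduct_add_eq_zero_iff hτ] at h4
  rw [toComplex_dotProduct_add_eq_zero_iff hρ] at h5
  have hQY : Q ≠ Y := fun h => hQ (h ▸ h4)
  have hRZ : R ≠ Z := fun h => hR (h ▸ h5)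
  rw [foldEquation_iff_fold_mem hπ hQY] at h1
  rw [foldEquation_iff_fold_mem hπ hRZ] at h2
  rw [← toComplex_sub, ← toComplex_sub, ← toComplex_smul] at h3
  have h3' := toComplex_injective h3
  -- Since `Y - Q = l • (Z - R)`, both folds move `P` along `Z - R`, and both place it on `π`.
  have heq : perpHyperplane Q Y hQY = perpHyperplane R Z hRZ := by
    refine eq_of_fold_mem hπ hP h1 h2 (w := Z - R) (r := ?_) (r' := ?_) ?_ ?_
    · exact -(((2 * ⟪Y - Q, P⟫ - (⟪Y, Y⟫ - ⟪Q, Q⟫)) / ⟪Y - Q, Y - Q⟫) * l)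
    · exact -((2 * ⟪Z - R, P⟫ - (⟪Z, Z⟫ - ⟪R, R⟫)) / ⟪Z - R, Z - R⟫)
    · rw [neg_smul, mul_smul, ← h3', fold_perpHyperplane, sub_eq_add_neg]
    · rw [neg_smul, fold_perpHyperplane, sub_eq_add_neg]
  refine ⟨perpHyperplane Q Y hQY, ⟨h1, ?_, ?_⟩, (solutionPlane_mk Q _ Y _).symm, ?_, ?_⟩
  · rwa [fold_perpHyperplane_left]
  · rwa [heq, fold_perpHyperplane_left]
  · simp only [fold_perpHyperplane_left]
  · simp only [heq, fold_perpHyperplane_left]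

/-- A fold plane determines `Q'` and `R'` as images, and then `ℓ`, because `R' ≠ R`. Conversely, a
fold displaces `Q` and `R` by multiples of its normal vector, and `ℓ` is the ratio of these
multiples. -/
theorem bijOn_solutionPlane
    (hP : P ∉ π.points) (hQ : Q ∉ τ.points) (hR : R ∉ ρ.points)
    (hπ : HasEquation π a d) (hτ : HasEquation τ b e) (hρ : HasEquation ρ c f) :
    Set.BijOn (solutionPlane Q)
      {s ∈ complexSolutions P Q R a b c d e f | IsRealSolution s}
      (Subtype.val '' foldPlanes P Q R π τ ρ) := by
  refine ⟨fun s hs => ?_, fun s hs s' hs' hss => ?_, ?_⟩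
  · obtain ⟨Δ, hΔ, h, -⟩ := exists_fold_of_mem_complexSolutions hP hQ hR hπ hτ hρ hs.1 hs.2
    exact ⟨Δ, hΔ, h⟩
  · obtain ⟨Δ, hΔ, h1, h2, h3⟩ :=
      exists_fold_of_mem_complexSolutions hP hQ hR hπ hτ hρ hs.1 hs.2
    obtain ⟨Δ', hΔ', h1', h2', h3'⟩ :=
      exists_fold_of_mem_complexSolutions hP hQ hR hπ hτ hρ hs'.1 hs'.2
    obtain rfl : Δ = Δ' := Hyperplane.ext_val (by rw [h1, h1', hss])
    have e1 := hs.1.2.2.1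
    have e2 := hs'.1.2.2.1
    rw [h2, h3] at e1
    rw [h2', h3', e1] at e2
    have hne : toComplex (fold Δ R) - toComplex R ≠ 0 := fun h0 =>
      hR (toComplex_injective (sub_eq_zero.1 h0) ▸ hΔ.2.2)
    exact Prod.ext (smul_left_injective ℂ hne e2)
      (Prod.ext (h2.trans h2'.symm) (h3.trans h3'.symm))
  · rintro _ ⟨Δ, ⟨h1, h2, h3⟩, rfl⟩
    have hQY : Q ≠ fold Δ Q := fun h => hQ (h ▸ h2)
    have hRZ : R ≠ fold Δ R := fun h => hR (h ▸ h3)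
    obtain ⟨n, t, hn, hnt⟩ := Hyperplane.exists_normal Δ
    have hfold := fold_eq_of_normal hn hnt
    have hr0 : 2 * (⟪n, R⟫ - t) / ⟪n, n⟫ ≠ 0 := fun h0 => hRZ (by rw [hfold R, h0]; simp)
    refine ⟨(((2 * (⟪n, Q⟫ - t) / ⟪n, n⟫) / (2 * (⟪n, R⟫ - t) / ⟪n, n⟫) : ℝ),
      toComplex (fold Δ Q), toComplex (fold Δ R)), ⟨⟨?_, ?_, ?_, ?_, ?_⟩, isRealSolution_mk _ _ _⟩,
      ?_⟩
    · rw [foldEquation_iff_fold_mem hπ hQY, ← eq_perpHyperplane rfl hQY]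
      exact h1
    · rw [foldEquation_iff_fold_mem hπ hRZ, ← eq_perpHyperplane rfl hRZ]
      exact h1
    · simp only
      rw [← toComplex_sub, ← toComplex_sub, ← toComplex_smul, hfold Q, hfold R,
        sub_sub_cancel_left, sub_sub_cancel_left, smul_neg, smul_smul, div_mul_cancel₀ _ hr0]
    · exact (toComplex_dotProduct_add_eq_zero_iff hτ _).2 h2
    · exact (toComplex_dotProduct_add_eq_zero_iff hρ _).2 h3
    · rw [solutionPlane_mk]
      exact (congrArg Subtype.val (eq_perpHyperplane rfl hQY)).symm

end Bijection

end Origami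

/-! ### Reduction of the system to two plane cubics -/

namespace Origami

open MvPolynomial

local notation "⟪" x ", " y "⟫" => inner ℝ x y

/-- The coordinates of a general point of the plane `c ⬝ v = -γ`, where `c i ≠ 0`, in terms of its
coordinates other than the `i`-th one. -/
def chart (i : Fin 3) (c : E 3) (γ : ℝ) : Fin 3 → MvPolynomial (Fin 2) ℝ :=
  Fin.insertNth (α := fun _ => MvPolynomial (Fin 2) ℝ) i
    (C (c i)⁻¹ * (-C γ - ∑ k, C (c (i.succAbove k)) * X k)) X

/-- The linear form `a ⬝ V`. -/
def linPoly (a : E 3) (V : Fin 3 → MvPolynomial (Fin 2) ℝ) : MvPolynomial (Fin 2) ℝ :=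
  ∑ j, C (a j) * V j

/-- The quadratic form `V ⬝ V`. -/
def normPoly (V : Fin 3 → MvPolynomial (Fin 2) ℝ) : MvPolynomial (Fin 2) ℝ := ∑ j, V j ^ 2

/-- The cubic form that vanishes at the normal vectors of those planes which place `P` onto
`a ⬝ x + d = 0` and `X` onto `b ⬝ x + e = 0`, where `α = a ⬝ P + d` and `β = b ⬝ X + e`. -/
def foldPoly (P X a b : E 3) (α β : ℝ) (V : Fin 3 → MvPolynomial (Fin 2) ℝ) :
    MvPolynomial (Fin 2) ℝ :=
  (C α * linPoly b V - C β * linPoly a V) * normPoly V +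
    linPoly a V * linPoly ((2 : ℝ) • (X - P)) V * linPoly b V

/-- The point with the given coordinates in the chart. -/
def chartPoint (i : Fin 3) (c : E 3) (γ : ℝ) (z : Fin 2 → ℂ) : Fin 3 → ℂ :=
  fun j => aeval z (chart i c γ j)

/-- The solution of the polynomial system with `R' - R` the given point of the chart. -/
def solutionAt (Q R b c : E 3) (β γ : ℝ) (i : Fin 3) (z : Fin 2 → ℂ) :
    ℂ × (Fin 3 → ℂ) × (Fin 3 → ℂ) :=
  (-β / (toComplex b ⬝ᵥ chartPoint i c γ z),
    toComplex Q + (-β / (toComplex b ⬝ᵥ chartPoint i c γ z)) • chartPoint i c γ z,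
    toComplex R + chartPoint i c γ z)

theorem chart_succAbove (i : Fin 3) (c : E 3) (γ : ℝ) (k : Fin 2) :
    chart i c γ (i.succAbove k) = X k := by
  simp [chart]

theorem linPoly_chart_self {i : Fin 3} {c : E 3} (hi : c i ≠ 0) (γ : ℝ) :
    linPoly c (chart i c γ) = C (-γ) := by
  rw [linPoly, Fin.sum_univ_succAbove _ i]
  simp only [chart_succAbove]
  rw [chart, Fin.insertNth_apply_same, ← mul_assoc, ← C_mul, mul_inv_cancel₀ hi, C_1, C_neg]
  ring

theorem aeval_linPoly (a : E 3) (i : Fin 3) (c : E 3) (γ : ℝ) (z : Fin 2 → ℂ) :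
    aeval z (linPoly a (chart i c γ)) = toComplex a ⬝ᵥ chartPoint i c γ z := by
  simp [linPoly, chartPoint, dotProduct, toComplex]

theorem dotProduct_chartPoint_self {i : Fin 3} {c : E 3} (hi : c i ≠ 0) (γ : ℝ) (z : Fin 2 → ℂ) :
    toComplex c ⬝ᵥ chartPoint i c γ z = -γ := by
  rw [← aeval_linPoly, linPoly_chart_self hi]; simp

theorem chartPoint_succAbove (i : Fin 3) (c : E 3) (γ : ℝ) (z : Fin 2 → ℂ) (k : Fin 2) :
    chartPoint i c γ z (i.succAbove k) = z k := by
  simp [chartPoint, chart_succAbove]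

theorem chartPoint_eq {i : Fin 3} {c : E 3} (hi : c i ≠ 0) {γ : ℝ} {v : Fin 3 → ℂ}
    (hv : toComplex c ⬝ᵥ v = -γ) : chartPoint i c γ (fun k => v (i.succAbove k)) = v := by
  have h := dotProduct_chartPoint_self hi γ fun k => v (i.succAbove k)
  rw [← hv, dotProduct, dotProduct, Fin.sum_univ_succAbove _ i, Fin.sum_univ_succAbove _ i] at h
  simp only [chartPoint_succAbove, add_left_inj] at h
  have hi' : toComplex c i ≠ 0 := by simpa [toComplex] using hi
  refine funext fun j => ?_
  rcases Fin.eq_self_or_eq_succAbove i j with rfl | ⟨k, rfl⟩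
  · exact mul_left_cancel₀ hi' h
  · exact chartPoint_succAbove _ _ _ _ _

theorem chartPoint_ofReal (i : Fin 3) (c : E 3) (γ : ℝ) (x : Fin 2 → ℝ) :
    ∃ v : E 3, chartPoint i c γ (fun k => (x k : ℂ)) = toComplex v := by
  refine ⟨WithLp.toLp 2 fun j => eval x (chart i c γ j), funext fun j => ?_⟩
  exact aeval_algebraMap_apply ℂ x _

theorem aeval_foldPoly (P X a b : E 3) (α β : ℝ) (i : Fin 3) (c : E 3) (γ : ℝ) (z : Fin 2 → ℂ) :
    aeval z (foldPoly P X a b α β (chart i c γ)) =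
      (α * (toComplex b ⬝ᵥ chartPoint i c γ z) - β * (toComplex a ⬝ᵥ chartPoint i c γ z)) *
        (chartPoint i c γ z ⬝ᵥ chartPoint i c γ z) +
      (toComplex a ⬝ᵥ chartPoint i c γ z) *
        (2 * ((toComplex X - toComplex P) ⬝ᵥ chartPoint i c γ z)) *
        (toComplex b ⬝ᵥ chartPoint i c γ z) := by
  simp only [foldPoly, map_add, map_sub, map_mul, aeval_linPoly, toComplex_smul, toComplex_sub,
    smul_dotProduct, smul_eq_mul, algHom_C, Complex.coe_algebraMap]
  have : aeval z (normPoly (chart i c γ)) = chartPoint i c γ z ⬝ᵥ chartPoint i c γ z := by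
    simp [normPoly, chartPoint, dotProduct, sq]
  rw [this]
  norm_num

/-- The fold equation in terms of the direction `v` of the normal vectors. -/
theorem foldEquation_add_smul_iff (P X a b : E 3) (d β : ℝ) (hβ : β ≠ 0) (v : Fin 3 → ℂ) (t : ℂ)
    (ht : t * (toComplex b ⬝ᵥ v) = -β) :
    FoldEquation P a d (toComplex X) (toComplex X + t • v) ↔
      (((⟪a, P⟫ + d : ℝ) : ℂ) * (toComplex b ⬝ᵥ v) - β * (toComplex a ⬝ᵥ v)) * (v ⬝ᵥ v) +
        (toComplex a ⬝ᵥ v) * (2 * ((toComplex X - toComplex P) ⬝ᵥ v)) * (toComplex b ⬝ᵥ v) = 0 := by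
  have hβ' : (-β : ℂ) ≠ 0 := by simpa using hβ
  have htne : t ≠ 0 := by rintro rfl; exact hβ' (by rw [← ht, zero_mul])
  have hB : toComplex b ⬝ᵥ v ≠ 0 := fun h => hβ' (by rw [← ht, h, mul_zero])
  simp only [FoldEquation, add_sub_cancel_left, dotProduct_smul, smul_dotProduct, add_dotProduct,
    dotProduct_add, smul_eq_mul, sub_dotProduct, dotProduct_comm v (toComplex X), Complex.ofReal_add,
    ← toComplex_dotProduct]
  generalize toComplex b ⬝ᵥ v = B at *
  generalize toComplex a ⬝ᵥ v = A at *
  generalize toComplex a ⬝ᵥ toComplex P + (d : ℂ) = α at *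
  generalize toComplex P ⬝ᵥ v = p at *
  generalize toComplex X ⬝ᵥ v = x at *
  generalize v ⬝ᵥ v = N at *
  -- With `X' - X = t • v`, the fold equation is `t²` times `A (2 x + t N) = 2 p A - α N`.
  -- Multiplying by `B` and replacing `t B` by `-β` yields the cubic; `t` and `B` are non-zero
  -- because `β` is.
  constructor
  · intro H
    refine mul_left_cancel₀ (pow_ne_zero 2 htne) ?_
    linear_combination B * H - t ^ 2 * A * N * ht
  · intro H
    refine mul_left_cancel₀ hB ?_
    linear_combination t ^ 2 * H + t ^ 2 * A * N * ht

theorem totalDegree_chart_le (i : Fin 3) (c : E 3) (γ : ℝ) (j : Fin 3) :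
    (chart i c γ j).totalDegree ≤ 1 := by
  rcases Fin.eq_self_or_eq_succAbove i j with rfl | ⟨k, rfl⟩
  · rw [chart, Fin.insertNth_apply_same]
    refine (totalDegree_mul _ _).trans ?_
    rw [totalDegree_C, zero_add]
    refine (totalDegree_sub _ _).trans (max_le ?_ (totalDegree_finsetSum_le fun k _ => ?_))
    · rw [totalDegree_neg, totalDegree_C]; exact Nat.zero_le _
    · refine (totalDegree_mul _ _).trans ?_
      rw [totalDegree_C, totalDegree_X]
  · rw [chart_succAbove, totalDegree_X]

theorem totalDegree_linPoly_le {V : Fin 3 → MvPolynomial (Fin 2) ℝ}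
    (hV : ∀ j, (V j).totalDegree ≤ 1) (a : E 3) : (linPoly a V).totalDegree ≤ 1 :=
  totalDegree_finsetSum_le fun j _ => (totalDegree_mul _ _).trans (by
    rw [totalDegree_C, zero_add]; exact hV j)

theorem totalDegree_normPoly_le {V : Fin 3 → MvPolynomial (Fin 2) ℝ}
    (hV : ∀ j, (V j).totalDegree ≤ 1) : (normPoly V).totalDegree ≤ 2 :=
  totalDegree_finsetSum_le fun j _ => (totalDegree_pow _ _).trans (by have := hV j; omega)

theorem totalDegree_foldPoly_le {V : Fin 3 → MvPolynomial (Fin 2) ℝ}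
    (hV : ∀ j, (V j).totalDegree ≤ 1)
    (P X a b : E 3) (α β : ℝ) :
    (foldPoly P X a b α β V).totalDegree ≤ 3 := by
  have h1 := totalDegree_linPoly_le hV
  have h2 := totalDegree_normPoly_le hV
  refine (totalDegree_add _ _).trans (max_le ?_ ?_)
  · refine (totalDegree_mul _ _).trans (Nat.add_le_add (b := 1) ?_ h2)
    refine (totalDegree_sub _ _).trans (max_le ?_ ?_)
    all_goals
      refine (totalDegree_mul _ _).trans ?_
      rw [totalDegree_C, zero_add]
      exact h1 _
  · exact (totalDegree_mul _ _).trans (Nat.add_le_add ((totalDegree_mul _ _).trans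
      (Nat.add_le_add (h1 _) (h1 _))) (h1 _))

end Origami

/-! ### Counting complex, non-real and real solutions -/

namespace Origami

open MvPolynomial

local notation "⟪" x ", " y "⟫" => inner ℝ x y

section System

variable {P Q R : E 3} {a b c : E 3} {d e f : ℝ}

/-- The points of the chart that correspond to solutions of the system. -/
def chartZeros (P Q R a b c : E 3) (α β γ : ℝ) (i : Fin 3) : Set (Fin 2 → ℂ) :=
  {z | aeval z (foldPoly P Q a b α β (chart i c γ)) = 0 ∧
    aeval z (foldPoly P R a c α γ (chart i c γ)) = 0 ∧ aeval z (linPoly b (chart i c γ)) ≠ 0}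

theorem solutionAt_injective (Q R b c : E 3) (β γ : ℝ) (i : Fin 3) :
    Function.Injective (solutionAt Q R b c β γ i) := by
  intro z w h
  have h1 : chartPoint i c γ z = chartPoint i c γ w :=
    add_left_cancel (congrArg (fun s => s.2.2) h)
  refine _root_.funext fun k => ?_
  rw [← chartPoint_succAbove i c γ z, h1, chartPoint_succAbove]

/-- For `v = R' - R`, the plane equations read `c ⬝ v = -γ` and `ℓ (b ⬝ v) = -β`. As `β ≠ 0`, the
second forces `b ⬝ v ≠ 0` and determines `ℓ`; what remains are the two cubics. -/
theorem complexSolutions_eq_image {i : Fin 3} (hi : c i ≠ 0) (hβ : ⟪b, Q⟫ + e ≠ 0)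
    (hγ : ⟪c, R⟫ + f ≠ 0) :
    complexSolutions P Q R a b c d e f =
      solutionAt Q R b c (⟪b, Q⟫ + e) (⟪c, R⟫ + f) i ''
        chartZeros P Q R a b c (⟪a, P⟫ + d) (⟪b, Q⟫ + e) (⟪c, R⟫ + f) i := by
  have hβ' : ((⟪b, Q⟫ + e : ℝ) : ℂ) = toComplex b ⬝ᵥ toComplex Q + e := by
    rw [toComplex_dotProduct]; push_cast; rfl
  have hγ' : ((⟪c, R⟫ + f : ℝ) : ℂ) = toComplex c ⬝ᵥ toComplex R + f := by
    rw [toComplex_dotProduct]; push_cast; rfl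
  ext s
  constructor
  · rintro ⟨h1, h2, h3, h4, h5⟩
    obtain ⟨l, Y, Z⟩ := s
    simp only at h1 h2 h3 h4 h5
    obtain ⟨v, rfl⟩ : ∃ v, Z = toComplex R + v := ⟨Z - toComplex R, by abel⟩
    rw [add_sub_cancel_left, sub_eq_iff_eq_add, add_comm] at h3
    subst h3
    rw [dotProduct_add, add_right_comm, ← hγ'] at h5
    rw [dotProduct_add, add_right_comm, ← hβ', dotProduct_smul, smul_eq_mul] at h4
    have h5' : toComplex c ⬝ᵥ v = -((⟪c, R⟫ + f : ℝ) : ℂ) := by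
      linear_combination h5
    have h4' : l * (toComplex b ⬝ᵥ v) = -((⟪b, Q⟫ + e : ℝ) : ℂ) := by linear_combination h4
    have hB : toComplex b ⬝ᵥ v ≠ 0 := fun h0 => hβ (by
      rw [h0, mul_zero] at h4'
      exact_mod_cast (neg_eq_zero.1 h4'.symm))
    have hv := chartPoint_eq hi h5'
    refine ⟨fun k => v (i.succAbove k), ⟨?_, ?_, ?_⟩, ?_⟩
    · rw [aeval_foldPoly, hv]
      exact (foldEquation_add_smul_iff P Q a b d _ hβ v l h4').1 h1
    · rw [aeval_foldPoly, hv]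
      refine (foldEquation_add_smul_iff P R a c d _ hγ v 1 ?_).1 ?_
      · rw [one_mul, h5']
      · rwa [one_smul]
    · rwa [aeval_linPoly, hv]
    · rw [solutionAt, hv, ← h4', mul_div_cancel_right₀ _ hB]
  · rintro ⟨z, ⟨h1, h2, h3⟩, rfl⟩
    rw [aeval_foldPoly] at h1 h2
    rw [aeval_linPoly] at h3
    have h4 := dotProduct_chartPoint_self hi (⟪c, R⟫ + f) z
    have h5 := div_mul_cancel₀ (-((⟪b, Q⟫ + e : ℝ) : ℂ)) h3
    refine ⟨(foldEquation_add_smul_iff P Q a b d _ hβ _ _ h5).2 h1, ?_, ?_, ?_, ?_⟩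
    · have := (foldEquation_add_smul_iff P R a c d _ hγ _ 1 (by rw [one_mul, h4])).2 h2
      rwa [one_smul] at this
    · simp [solutionAt]
    · rw [solutionAt, dotProduct_add, dotProduct_smul, smul_eq_mul, h5, hβ']
      ring
    · rw [solutionAt, dotProduct_add, h4, hγ']
      ring

theorem exists_ne_zero_of_ne {c : E 3} (hc : c ≠ 0) : ∃ i, c i ≠ 0 := by
  by_contra! h
  exact hc (by ext i; simpa using h i)

theorem totalDegree_map_le (p : MvPolynomial (Fin 2) ℝ) :
    (map (algebraMap ℝ ℂ) p).totalDegree ≤ p.totalDegree := by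
  rw [totalDegree, Finset.sup_le_iff]
  exact fun m hm => le_totalDegree (support_map_subset _ _ hm)

theorem ncard_complexSolutions_le_nine (hc : c ≠ 0) (hβ : ⟪b, Q⟫ + e ≠ 0)
    (hγ : ⟪c, R⟫ + f ≠ 0) (hfin : (complexSolutions P Q R a b c d e f).Finite) :
    (complexSolutions P Q R a b c d e f).ncard ≤ 9 := by
  obtain ⟨i, hi⟩ := exists_ne_zero_of_ne hc
  have hinj := solutionAt_injective Q R b c (⟪b, Q⟫ + e) (⟪c, R⟫ + f) i
  rw [complexSolutions_eq_image hi hβ hγ] at hfin ⊢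
  rw [Set.ncard_image_of_injective _ hinj]
  have hfin' := (Set.finite_image_iff hinj.injOn).1 hfin
  have hV := totalDegree_chart_le i c (⟪c, R⟫ + f)
  have hmap : ∀ (p : MvPolynomial (Fin 2) ℝ) (z : Fin 2 → ℂ),
      aeval z p = eval z (map (algebraMap ℝ ℂ) p) := fun p z =>
    by rw [aeval_def, eval₂_eq_eval_map]
  simp only [chartZeros, hmap] at hfin' ⊢
  have h1 := (totalDegree_map_le _).trans
    (totalDegree_foldPoly_le hV P Q a b (⟪a, P⟫ + d) (⟪b, Q⟫ + e))
  have h2 := (totalDegree_map_le _).trans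
    (totalDegree_foldPoly_le hV P R a c (⟪a, P⟫ + d) (⟪c, R⟫ + f))
  exact (ncard_common_zeros_le h1 h2 hfin').trans_eq (by norm_num)

theorem aeval_ofReal (x : Fin 2 → ℝ) (p : MvPolynomial (Fin 2) ℝ) :
    aeval (fun k => (x k : ℂ)) p = (eval x p : ℝ) :=
  aeval_algebraMap_apply ℂ x p

theorem isRealSolution_solutionAt_iff (Q R b c : E 3) (β γ : ℝ) (i : Fin 3) (z : Fin 2 → ℂ) :
    IsRealSolution (solutionAt Q R b c β γ i z) ↔ ∃ x : Fin 2 → ℝ, z = fun k => (x k : ℂ) := by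
  constructor
  · rintro ⟨-, -, h⟩
    refine ⟨fun k => (z k).re, _root_.funext fun k => Complex.ext rfl ?_⟩
    have := h (i.succAbove k)
    simpa [solutionAt, chartPoint_succAbove, toComplex] using this
  · rintro ⟨x, rfl⟩
    obtain ⟨v, hv⟩ := chartPoint_ofReal i c γ x
    rw [solutionAt, hv, toComplex_dotProduct]
    have h1 : (-β / (⟪b, v⟫ : ℝ) : ℂ) = ((-β / ⟪b, v⟫ : ℝ) : ℂ) := by push_cast; rfl
    have h2 : ∀ x y : E 3, toComplex x + toComplex y = toComplex (x + y) := fun x y => by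
      ext; simp [toComplex]
    rw [h1, ← toComplex_smul, h2, h2]
    exact isRealSolution_mk _ _ _

theorem realSolutions_eq_image {i : Fin 3} (hi : c i ≠ 0) (hβ : ⟪b, Q⟫ + e ≠ 0)
    (hγ : ⟪c, R⟫ + f ≠ 0) :
    {s ∈ complexSolutions P Q R a b c d e f | IsRealSolution s} =
      (fun x : Fin 2 → ℝ =>
        solutionAt Q R b c (⟪b, Q⟫ + e) (⟪c, R⟫ + f) i fun k => (x k : ℂ)) ''
        {x | eval x (foldPoly P Q a b (⟪a, P⟫ + d) (⟪b, Q⟫ + e) (chart i c (⟪c, R⟫ + f))) = 0 ∧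
          eval x (foldPoly P R a c (⟪a, P⟫ + d) (⟪c, R⟫ + f) (chart i c (⟪c, R⟫ + f))) = 0 ∧
          eval x (linPoly b (chart i c (⟪c, R⟫ + f))) ≠ 0} := by
  have hmem : ∀ x : Fin 2 → ℝ, (fun k => (x k : ℂ)) ∈
      chartZeros P Q R a b c (⟪a, P⟫ + d) (⟪b, Q⟫ + e) (⟪c, R⟫ + f) i ↔ x ∈
      {x | eval x (foldPoly P Q a b (⟪a, P⟫ + d) (⟪b, Q⟫ + e) (chart i c (⟪c, R⟫ + f))) = 0 ∧
          eval x (foldPoly P R a c (⟪a, P⟫ + d) (⟪c, R⟫ + f) (chart i c (⟪c, R⟫ + f))) = 0 ∧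
          eval x (linPoly b (chart i c (⟪c, R⟫ + f))) ≠ 0} := fun x => by
    simp only [chartZeros, Set.mem_ofPred_eq, aeval_ofReal]
    norm_cast
  rw [complexSolutions_eq_image hi hβ hγ]
  ext s
  constructor
  · rintro ⟨⟨z, hz, rfl⟩, hs⟩
    obtain ⟨x, rfl⟩ := (isRealSolution_solutionAt_iff _ _ _ _ _ _ _ _).1 hs
    exact ⟨x, (hmem x).1 hz, rfl⟩
  · rintro ⟨x, hx, rfl⟩
    exact ⟨⟨_, (hmem x).2 hx, rfl⟩, (isRealSolution_solutionAt_iff _ _ _ _ _ _ _ _).2 ⟨x, rfl⟩⟩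

/-- If `b` is a multiple of `a`, the cubic of the fold decomposes. -/
def conicPoly (P X a : E 3) (μ α β : ℝ) (V : Fin 3 → MvPolynomial (Fin 2) ℝ) :
    MvPolynomial (Fin 2) ℝ :=
  C (α * μ - β) * normPoly V + C μ * (linPoly a V * linPoly ((2 : ℝ) • (X - P)) V)

theorem linPoly_smul (μ : ℝ) (a : E 3) (V : Fin 3 → MvPolynomial (Fin 2) ℝ) :
    linPoly (μ • a) V = C μ * linPoly a V := by
  simp [linPoly, Finset.mul_sum, mul_assoc]

theorem foldPoly_smul (P X a : E 3) (μ α β : ℝ) (V : Fin 3 → MvPolynomial (Fin 2) ℝ) :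
    foldPoly P X a (μ • a) α β V = linPoly a V * conicPoly P X a μ α β V := by
  rw [foldPoly, conicPoly, linPoly_smul, C_sub, C_mul]
  ring

theorem totalDegree_conicPoly_le {V : Fin 3 → MvPolynomial (Fin 2) ℝ}
    (hV : ∀ j, (V j).totalDegree ≤ 1) (P X a : E 3) (μ α β : ℝ) :
    (conicPoly P X a μ α β V).totalDegree ≤ 2 := by
  refine (totalDegree_add _ _).trans (max_le ?_ ?_) <;> refine (totalDegree_mul _ _).trans ?_ <;>
    rw [totalDegree_C, zero_add]
  · exact totalDegree_normPoly_le hV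
  · exact (totalDegree_mul _ _).trans
      (Nat.add_le_add (totalDegree_linPoly_le hV _) (totalDegree_linPoly_le hV _))

/-- An isotropic vector orthogonal to `a` that is not orthogonal to vectors independent of `a`. -/
theorem exists_isotropic {a : E 3} (ha : a ≠ 0) :
    ∃ z : Fin 3 → ℂ, toComplex a ⬝ᵥ z = 0 ∧ z ⬝ᵥ z = 0 ∧
      ∀ b : E 3, (∀ μ : ℝ, b ≠ μ • a) → toComplex b ⬝ᵥ z ≠ 0 := by
  have : Fact (Module.finrank ℝ (E 3) = 2 + 1) := ⟨finrank_euclideanSpace_fin⟩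
  have hrk := Submodule.finrank_orthogonal_span_singleton (𝕜 := ℝ) (n := 2) ha
  let u := (stdOrthonormalBasis ℝ (Submodule.span ℝ {a})ᗮ).reindex (finCongr hrk)
  let p : E 3 := u 0
  let q : E 3 := u 1
  have hap : ⟪a, p⟫ = 0 := Submodule.mem_orthogonal_singleton_iff_inner_right.1 (u 0).2
  have haq : ⟪a, q⟫ = 0 := Submodule.mem_orthogonal_singleton_iff_inner_right.1 (u 1).2
  have hpp : ⟪p, p⟫ = 1 := (u.inner_eq_ite 0 0).trans (by simp)
  have hqq : ⟪q, q⟫ = 1 := (u.inner_eq_ite 1 1).trans (by simp)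
  have hpq : ⟪p, q⟫ = 0 := (u.inner_eq_ite 0 1).trans (by simp)
  -- The isotropic vector is `p + i q`, with `p`, `q` an orthonormal basis of the plane orthogonal
  -- to `a`.
  have hz : ∀ b : E 3, toComplex b ⬝ᵥ (toComplex p + Complex.I • toComplex q) =
      (⟪b, p⟫ : ℝ) + Complex.I * (⟪b, q⟫ : ℝ) := fun b => by
    rw [dotProduct_add, dotProduct_smul, toComplex_dotProduct, toComplex_dotProduct, smul_eq_mul]
  refine ⟨toComplex p + Complex.I • toComplex q, ?_, ?_, fun b hb h => ?_⟩
  · rw [hz, hap, haq]; simp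
  · rw [add_dotProduct, smul_dotProduct, hz, hz, hpp, hqq, hpq, real_inner_comm, hpq]
    simp
  · rw [hz] at h
    have h1 : ⟪b, p⟫ = 0 := by simpa using congrArg Complex.re h
    have h2 : ⟪b, q⟫ = 0 := by simpa using congrArg Complex.im h
    -- A real `b` orthogonal to `p + i q` is orthogonal to `p` and to `q`, hence a multiple of `a`.
    have hmem : b ∈ (Submodule.span ℝ {a})ᗮᗮ := by
      rw [Submodule.mem_orthogonal']
      intro w hw
      have hw' := u.sum_repr ⟨w, hw⟩
      rw [Fin.sum_univ_two] at hw'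
      have hw2 : u.repr ⟨w, hw⟩ 0 • p + u.repr ⟨w, hw⟩ 1 • q = w := congrArg Subtype.val hw'
      rw [← hw2, inner_add_right, inner_smul_right, inner_smul_right, h1, h2]
      simp
    rw [Submodule.orthogonal_orthogonal, Submodule.mem_span_singleton] at hmem
    obtain ⟨μ, hμ⟩ := hmem
    exact hb μ hμ.symm

/-- A real isotropic vector is zero; then `R' = R` would lie on the plane of `c` and `f`, against
`hγ`. -/
theorem not_isRealSolution_of_isotropic (hγ : ⟪c, R⟫ + f ≠ 0)
    {s : ℂ × (Fin 3 → ℂ) × (Fin 3 → ℂ)} (hs : s ∈ complexSolutions P Q R a b c d e f)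
    (hiso : (s.2.2 - toComplex R) ⬝ᵥ (s.2.2 - toComplex R) = 0) : ¬ IsRealSolution s := by
  intro h
  obtain ⟨l, Y, Z, rfl⟩ := h.exists_eq
  simp only [← toComplex_sub, toComplex_dotProduct] at hiso
  have h0 : Z = R := by
    rw [← sub_eq_zero, ← inner_self_eq_zero (𝕜 := ℝ)]
    exact_mod_cast hiso
  have h5 := hs.2.2.2.2
  simp only [h0, toComplex_dotProduct] at h5
  exact hγ (by exact_mod_cast h5)

/-- If neither `b` nor `c` is a multiple of `a`, there is a solution with isotropic `R' - R`. -/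
theorem exists_isotropic_solution (ha : a ≠ 0) (hγ : ⟪c, R⟫ + f ≠ 0) (hb : ∀ μ : ℝ, b ≠ μ • a)
    (hc : ∀ μ : ℝ, c ≠ μ • a) :
    ∃ s ∈ complexSolutions P Q R a b c d e f,
      (s.2.2 - toComplex R) ⬝ᵥ (s.2.2 - toComplex R) = 0 := by
  obtain ⟨z, hz1, hz2, hz⟩ := exists_isotropic ha
  have hbz := hz b hb
  have hcz := hz c hc
  have hγ' : toComplex c ⬝ᵥ toComplex R + f ≠ 0 := by
    rw [toComplex_dotProduct]; exact_mod_cast hγ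
  -- The scalars `t` and `u` place `R + t • z` and `Q + u • z` on their planes. The fold equations
  -- are then trivial, since each of their terms has a factor `a ⬝ w` or `w ⬝ w`.
  set t := -(toComplex c ⬝ᵥ toComplex R + f) / (toComplex c ⬝ᵥ z) with ht
  set u := -(toComplex b ⬝ᵥ toComplex Q + e) / (toComplex b ⬝ᵥ z) with hu
  have htne : t ≠ 0 := div_ne_zero (neg_ne_zero.2 hγ') hcz
  have htc : t * (toComplex c ⬝ᵥ z) = -(toComplex c ⬝ᵥ toComplex R + f) := div_mul_cancel₀ _ hcz
  have hub : u * (toComplex b ⬝ᵥ z) = -(toComplex b ⬝ᵥ toComplex Q + e) := div_mul_cancel₀ _ hbz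
  refine ⟨(u / t, toComplex Q + u • z, toComplex R + t • z), ⟨?_, ?_, ?_, ?_, ?_⟩, ?_⟩
  · simp [FoldEquation, hz1, hz2]
  · simp [FoldEquation, hz1, hz2]
  · simp only [add_sub_cancel_left, smul_smul, div_mul_cancel₀ _ htne]
  · simp only [dotProduct_add, dotProduct_smul, smul_eq_mul, hub]; ring
  · simp only [dotProduct_add, dotProduct_smul, smul_eq_mul, htc]; ring
  · simp [hz2]

theorem conj_dotProduct_toComplex (x : E 3) (v : Fin 3 → ℂ) :
    starRingEnd ℂ (toComplex x ⬝ᵥ v) = toComplex x ⬝ᵥ star v := by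
  simp [dotProduct, toComplex]

/-- The complex solutions are closed under conjugation. -/
theorem star_mem_complexSolutions {s : ℂ × (Fin 3 → ℂ) × (Fin 3 → ℂ)}
    (hs : s ∈ complexSolutions P Q R a b c d e f) :
    star s ∈ complexSolutions P Q R a b c d e f := by
  have hreal : ∀ x : E 3, star (toComplex x) = toComplex x := fun x => by
    ext i; simp [toComplex]
  have hfold : ∀ (X : E 3) (v : Fin 3 → ℂ), FoldEquation P a d (toComplex X) v →
      FoldEquation P a d (toComplex X) (star v) := by
    intro X v h
    have h1 := congrArg star h
    have h2 : ∀ v w : Fin 3 → ℂ, star (v ⬝ᵥ w) = star v ⬝ᵥ star w := fun v w => by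
      simp [dotProduct]
    simpa [FoldEquation, h2, hreal, mul_comm, mul_left_comm, mul_assoc] using h1
  obtain ⟨h1, h2, h3, h4, h5⟩ := hs
  refine ⟨hfold _ _ h1, hfold _ _ h2, ?_, ?_, ?_⟩
  · have := congrArg star h3
    rwa [star_sub, star_smul, star_sub, hreal, hreal] at this
  · have := congrArg (starRingEnd ℂ) h4
    rw [map_add, conj_dotProduct_toComplex, Complex.conj_ofReal, map_zero] at this
    exact this
  · have := congrArg (starRingEnd ℂ) h5
    rw [map_add, conj_dotProduct_toComplex, Complex.conj_ofReal, map_zero] at this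
    exact this

theorem isRealSolution_of_star_eq {s : ℂ × (Fin 3 → ℂ) × (Fin 3 → ℂ)} (h : star s = s) :
    IsRealSolution s :=
  ⟨Complex.conj_eq_iff_im.1 (congrArg Prod.fst h),
    fun i => Complex.conj_eq_iff_im.1 (congrFun (congrArg (fun s => s.2.1) h) i),
    fun i => Complex.conj_eq_iff_im.1 (congrFun (congrArg (fun s => s.2.2) h) i)⟩

/-- The two solutions are an isotropic one and its complex conjugate. -/
theorem two_le_encard_nonreal (ha : a ≠ 0) (hγ : ⟪c, R⟫ + f ≠ 0) (hb : ∀ μ : ℝ, b ≠ μ • a)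
    (hc : ∀ μ : ℝ, c ≠ μ • a) :
    2 ≤ {s ∈ complexSolutions P Q R a b c d e f | ¬ IsRealSolution s}.encard := by
  obtain ⟨s, hs, hiso⟩ :=
    exists_isotropic_solution (P := P) (Q := Q) (d := d) (e := e) ha hγ hb hc
  have hnr := not_isRealSolution_of_isotropic hγ hs hiso
  have hne : s ≠ star s := fun h => hnr (isRealSolution_of_star_eq h.symm)
  rw [← Set.encard_pair hne]
  refine Set.encard_le_encard (Set.insert_subset ⟨hs, hnr⟩ (Set.singleton_subset_iff.2
    ⟨star_mem_complexSolutions hs, fun h => hne ?_⟩))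
  obtain ⟨l, Y, Z, h⟩ := h.exists_eq
  rw [eq_comm, ← star_star s, h]
  refine Prod.ext ?_ (Prod.ext ?_ ?_) <;> [skip; ext i; ext i] <;> simp [toComplex]

theorem ncard_realSolutions_le_seven (ha : a ≠ 0) (hb : b ≠ 0) (hc : c ≠ 0)
    (hβ : ⟪b, Q⟫ + e ≠ 0) (hγ : ⟪c, R⟫ + f ≠ 0)
    (hfin : {s ∈ complexSolutions P Q R a b c d e f | IsRealSolution s}.Finite) :
    {s ∈ complexSolutions P Q R a b c d e f | IsRealSolution s}.ncard ≤ 7 := by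
  obtain ⟨i, hi⟩ := exists_ne_zero_of_ne hc
  have hinj : Function.Injective (fun x : Fin 2 → ℝ =>
      solutionAt Q R b c (⟪b, Q⟫ + e) (⟪c, R⟫ + f) i fun k => (x k : ℂ)) := fun x y h =>
    _root_.funext fun k => Complex.ofReal_injective
      (congrFun (solutionAt_injective Q R b c (⟪b, Q⟫ + e) (⟪c, R⟫ + f) i h) k)
  rw [realSolutions_eq_image hi hβ hγ] at hfin ⊢
  rw [Set.ncard_image_of_injective _ hinj]
  replace hfin := (Set.finite_image_iff hinj.injOn).1 hfin
  have hV := totalDegree_chart_le i c (⟪c, R⟫ + f)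
  -- If `b = μ • a`, the first cubic has the factor `a ⬝ v`, which is non-zero wherever `b ⬝ v` is,
  -- so it may be replaced by a conic.
  by_cases hba : ∃ μ : ℝ, b = μ • a
  · obtain ⟨μ, rfl⟩ := hba
    have hset : ∀ x, (eval x (foldPoly P Q a (μ • a) (⟪a, P⟫ + d) (⟪μ • a, Q⟫ + e)
        (chart i c (⟪c, R⟫ + f))) = 0 ∧
        eval x (foldPoly P R a c (⟪a, P⟫ + d) (⟪c, R⟫ + f) (chart i c (⟪c, R⟫ + f))) = 0 ∧
        eval x (linPoly (μ • a) (chart i c (⟪c, R⟫ + f))) ≠ 0) ↔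
        (eval x (conicPoly P Q a μ (⟪a, P⟫ + d) (⟪μ • a, Q⟫ + e) (chart i c (⟪c, R⟫ + f))) = 0 ∧
        eval x (foldPoly P R a c (⟪a, P⟫ + d) (⟪c, R⟫ + f) (chart i c (⟪c, R⟫ + f))) = 0 ∧
        eval x (linPoly (μ • a) (chart i c (⟪c, R⟫ + f))) ≠ 0) := fun x => by
      rw [foldPoly_smul, linPoly_smul, map_mul, map_mul, mul_eq_zero, mul_ne_zero_iff]
      exact ⟨fun ⟨h1, h2, h3⟩ => ⟨h1.resolve_left h3.2, h2, h3⟩,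
        fun ⟨h1, h2, h3⟩ => ⟨.inr h1, h2, h3⟩⟩
    simp only [hset] at hfin ⊢
    have h2 := totalDegree_conicPoly_le hV P Q a μ (⟪a, P⟫ + d) (⟪μ • a, Q⟫ + e)
    exact ncard_common_real_zeros_le_seven (h2.trans (by norm_num))
      (totalDegree_foldPoly_le hV _ _ _ _ _ _) (.inl h2) hfin
  by_cases hca : ∃ μ : ℝ, c = μ • a
  · obtain ⟨μ, hμ⟩ := hca
    -- If `c = μ • a`, then `μ (a ⬝ v) = -γ ≠ 0` on the whole chart, so the factor `a ⬝ v` of the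
    -- second cubic has no zeros there.
    have hne : ∀ x, eval x (linPoly a (chart i c (⟪c, R⟫ + f))) ≠ 0 := fun x h0 => by
      have h1 := congrArg (eval x) (linPoly_chart_self hi (⟪c, R⟫ + f))
      conv_lhs at h1 => rw [hμ]
      rw [linPoly_smul, ← hμ, map_mul, h0, mul_zero, eval_C] at h1
      exact hγ (neg_eq_zero.1 h1.symm)
    have hset : ∀ x, eval x (foldPoly P R a c (⟪a, P⟫ + d) (⟪c, R⟫ + f)
        (chart i c (⟪c, R⟫ + f))) = 0 ↔
        eval x (conicPoly P R a μ (⟪a, P⟫ + d) (⟪c, R⟫ + f) (chart i c (⟪c, R⟫ + f))) = 0 :=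
      fun x => by
        have h1 := foldPoly_smul P R a μ (⟪a, P⟫ + d) (⟪c, R⟫ + f) (chart i c (⟪c, R⟫ + f))
        rw [← hμ] at h1
        rw [h1, map_mul, mul_eq_zero, or_iff_right (hne x)]
    simp only [hset] at hfin ⊢
    have h2 := totalDegree_conicPoly_le hV P R a μ (⟪a, P⟫ + d) (⟪c, R⟫ + f)
    exact ncard_common_real_zeros_le_seven (totalDegree_foldPoly_le hV _ _ _ _ _ _)
      (h2.trans (by norm_num)) (.inr (.inl h2)) hfin
  push Not at hba hca
  -- In the remaining case the isotropic solution supplies the non-real common zero of the two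
  -- cubics.
  obtain ⟨s, hs, hiso⟩ :=
    exists_isotropic_solution (P := P) (Q := Q) (d := d) (e := e) ha hγ hba hca
  have hnr := not_isRealSolution_of_isotropic hγ hs hiso
  rw [complexSolutions_eq_image hi hβ hγ] at hs
  obtain ⟨z, ⟨hz1, hz2, -⟩, rfl⟩ := hs
  rw [isRealSolution_solutionAt_iff] at hnr
  obtain ⟨k, hk⟩ : ∃ k, (z k).im ≠ 0 := by
    by_contra! h
    exact hnr ⟨fun k => (z k).re, _root_.funext fun k => Complex.ext rfl (by simpa using h k)⟩
  exact ncard_common_real_zeros_le_seven (totalDegree_foldPoly_le hV _ _ _ _ _ _)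
    (totalDegree_foldPoly_le hV _ _ _ _ _ _) (.inr (.inr ⟨z, k, hk, hz1, hz2⟩)) hfin

end System

/-- The normal vector in the equation of a plane is not zero. -/
theorem HasEquation.ne_zero {π : Hyperplane 3} {a : E 3} {d : ℝ} (hπ : HasEquation π a d)
    {P : E 3} (hP : P ∉ π.points) : a ≠ 0 := by
  rintro rfl
  obtain ⟨x, hx⟩ := π.2.1
  have h1 := (hπ x).1 hx
  rw [hπ] at hP
  simp only [inner_zero_left] at h1 hP
  exact hP h1

theorem HasEquation.mem_direction_iff {π : Hyperplane 3} {a : E 3} {d : ℝ}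
    (hπ : HasEquation π a d) (v : E 3) : v ∈ π.1.direction ↔ ⟪a, v⟫ = 0 := by
  obtain ⟨x, hx⟩ := π.2.1
  have h1 := (hπ x).1 hx
  rw [← AffineSubspace.vadd_mem_iff_mem_direction v hx]
  change v + x ∈ π.points ↔ _
  rw [hπ, inner_add_right, add_assoc, h1, add_zero]

/-- By contraposition, non-parallel planes have the independent normals that the isotropic solution
requires. -/
theorem HasEquation.parallel {π τ : Hyperplane 3} {a b : E 3} {d e μ : ℝ}
    (hπ : HasEquation π a d) (hτ : HasEquation τ b e) (hb : b ≠ 0) (h : b = μ • a) :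
    τ.1.Parallel π.1 := by
  have hμ : μ ≠ 0 := by rintro rfl; exact hb (by rw [h, zero_smul])
  rw [AffineSubspace.parallel_iff_direction_eq_and_eq_bot_iff_eq_bot]
  refine ⟨?_, ?_⟩
  · ext v
    rw [hπ.mem_direction_iff, hτ.mem_direction_iff, h, inner_smul_left]
    simp [hμ]
  · have h1 := AffineSubspace.nonempty_iff_ne_bot _ |>.1 π.2.1
    have h2 := AffineSubspace.nonempty_iff_ne_bot _ |>.1 τ.2.1
    simp [h1, h2]

end Origami

/-! ### Planar origami: at most three fold lines -/

namespace Origami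

local notation "⟪" x ", " y "⟫" => inner ℝ x y

theorem Hyperplane.ext_points {k : ℕ} {Δ Δ' : Hyperplane k}
    (h : ∀ x, x ∈ Δ.points ↔ x ∈ Δ'.points) : Δ = Δ' :=
  Hyperplane.ext_val (SetLike.ext h)

theorem Hyperplane.eq_of_points_subset {k : ℕ} {Δ Δ' : Hyperplane k}
    (h : Δ.points ⊆ Δ'.points) : Δ = Δ' := by
  have hle : Δ.1 ≤ Δ'.1 := h
  refine Hyperplane.ext_val (AffineSubspace.eq_of_direction_eq_of_nonempty_of_le ?_ Δ.2.1 hle)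
  refine Submodule.eq_of_le_of_finrank_eq (AffineSubspace.direction_le hle) ?_
  have h1 := Δ.2.2
  have h2 := Δ'.2.2
  omega

/-- A line has a parametrization. -/
theorem Hyperplane.exists_param (m : Hyperplane 2) :
    ∃ x₀ e : E 2, e ≠ 0 ∧ ∀ x, x ∈ m.points ↔ ∃ s : ℝ, x = x₀ + s • e := by
  obtain ⟨x₀, hx₀⟩ := m.2.1
  obtain ⟨⟨e, he⟩, he0, hspan⟩ :=
    finrank_eq_one_iff'.1 (show Module.finrank ℝ m.1.direction = 1 by have := m.2.2; omega)
  refine ⟨x₀, e, fun h => he0 (Subtype.ext h), fun x => ⟨fun hx => ?_, ?_⟩⟩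
  · obtain ⟨s, hs⟩ := hspan ⟨x - x₀, AffineSubspace.vsub_mem_direction hx hx₀⟩
    refine ⟨s, ?_⟩
    have : s • e = x - x₀ := congrArg Subtype.val hs
    rw [this]; abel
  · rintro ⟨s, rfl⟩
    rw [add_comm]
    exact AffineSubspace.vadd_mem_of_mem_direction (m.1.direction.smul_mem s he) hx₀

theorem ncard_le_three_of_subsingleton {S : Set (Hyperplane 2)}
    (h : ∀ Δ ∈ S, ∀ Δ' ∈ S, Δ = Δ') : S.ncard ≤ 3 := by
  rcases Set.Subsingleton.eq_empty_or_singleton h with rfl | ⟨Δ, rfl⟩ <;> simp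

/-- Folds that place `P` onto a line, at points whose parameter is a zero of a nontrivial cubic. -/
theorem ncard_le_three_of_cubic {S : Set (Hyperplane 2)} {P x₀ e : E 2} {m : Hyperplane 2}
    (hP : P ∉ m.points) (hm : ∀ x, x ∈ m.points ↔ ∃ s : ℝ, x = x₀ + s • e)
    (hS : ∀ Δ ∈ S, fold Δ P ∈ m.points) (c₃ c₂ c₁ c₀ : ℝ)
    (hc : ¬ (c₃ = 0 ∧ c₂ = 0 ∧ c₁ = 0 ∧ c₀ = 0))
    (hroot : ∀ Δ ∈ S, ∀ s : ℝ, fold Δ P = x₀ + s • e →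
      c₃ * s ^ 3 + c₂ * s ^ 2 + c₁ * s + c₀ = 0) : S.ncard ≤ 3 := by
  classical
  let p : Polynomial ℝ := .C c₃ * .X ^ 3 + .C c₂ * .X ^ 2 + .C c₁ * .X + .C c₀
  have hp : p ≠ 0 := fun h0 => hc (by
    refine ⟨?_, ?_, ?_, ?_⟩
    · simpa [p, Polynomial.coeff_X, Polynomial.coeff_C] using congrArg (fun q => q.coeff 3) h0
    · simpa [p, Polynomial.coeff_X, Polynomial.coeff_C] using congrArg (fun q => q.coeff 2) h0
    · simpa [p, Polynomial.coeff_X, Polynomial.coeff_C] using congrArg (fun q => q.coeff 1) h0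
    · simpa [p, Polynomial.coeff_X, Polynomial.coeff_C] using congrArg (fun q => q.coeff 0) h0)
  choose! s hs using fun Δ hΔ => (hm _).1 (hS Δ hΔ)
  -- A fold that moves `P` is determined by the image of `P`, so the parameter of the image is
  -- injective on `S`.
  have h1 : S.ncard ≤ (p.roots.toFinset : Set ℝ).ncard := by
    refine Set.ncard_le_ncard_of_injOn s (fun Δ hΔ => ?_) (fun Δ hΔ Δ' hΔ' h => ?_)
      (Finset.finite_toSet _)
    · rw [Finset.mem_coe, Multiset.mem_toFinset, Polynomial.mem_roots hp]
      simpa [p] using hroot Δ hΔ _ (hs Δ hΔ)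
    · exact eq_of_fold_eq (P := P) (by rw [hs Δ hΔ, hs Δ' hΔ', h])
        fun h0 => hP (h0 ▸ hS Δ hΔ)
  rw [Set.ncard_coe_finset] at h1
  refine h1.trans ((Multiset.toFinset_card_le _).trans ((Polynomial.card_roots' p).trans ?_))
  exact Polynomial.natDegree_cubic_le

/-- The direction of a line `m` is normal to every fold line that reverses `m`. -/
theorem exists_of_reversed {m Δ : Hyperplane 2} {x₀ e : E 2}
    (hm : ∀ x, x ∈ m.points ↔ ∃ s : ℝ, x = x₀ + s • e)
    (h : PlanarIncidence.Holds Δ (.lineReversed m)) :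
    ∃ t : ℝ, ∀ x, x ∈ Δ.points ↔ ⟪e, x⟫ = t := by
  obtain ⟨himg, X, hX, hne⟩ := h
  have hY : fold Δ X ∈ m.points := himg ▸ Set.mem_image_of_mem _ hX
  obtain ⟨s, hs⟩ := (hm _).1 hX
  obtain ⟨r, hr⟩ := (hm _).1 hY
  have hrs : r - s ≠ 0 := fun h0 => hne (by rw [hr, hs, sub_eq_zero.1 h0])
  -- `Δ` is the bisector of the moved point `X` and its image, and both lie on `m`.
  have hsub : fold Δ X - X = (r - s) • e := by rw [hr, hs, sub_smul]; abel
  refine ⟨(⟪fold Δ X, fold Δ X⟫ - ⟪X, X⟫) / 2 / (r - s), fun x => ?_⟩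
  have h1 : x ∈ Δ.points ↔ x ∈ (perpHyperplane X (fold Δ X) hne.symm).points := by
    rw [← eq_perpHyperplane rfl hne.symm]
  rw [h1, mem_perpHyperplane, hsub, inner_smul_left, conj_trivial, eq_div_iff hrs, mul_comm]

theorem dist_fold_of_mem {k : ℕ} {Δ : Hyperplane k} {Q : E k} (hQ : fold Δ Q = Q) (X : E k) :
    dist (fold Δ X) Q = dist X Q := by
  have : Nonempty Δ.1 := Δ.2.1.to_subtype
  conv_lhs => rw [← hQ]
  exact (EuclideanGeometry.reflection Δ.1).dist_map X Q

/-- A point lies on infinitely many lines. -/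
theorem infinite_lines_through (P : E 2) : {Δ : Hyperplane 2 | P ∈ Δ.points}.Infinite := by
  let v : ℝ → E 2 := fun s => !₂[1, s]
  have hne : ∀ s, P - v s ≠ P + v s := fun s h => by
    have := congrArg (fun x : E 2 => x 0) h
    simp [v] at this
    linarith
  have hmem : ∀ s x, x ∈ (perpHyperplane _ _ (hne s)).points ↔ ⟪v s, x - P⟫ = 0 := fun s x => by
    rw [mem_perpHyperplane]
    simp only [inner_sub_left, inner_add_left, inner_sub_right, inner_add_right,
      real_inner_comm P (v s)]
    constructor <;> intro h <;> linarith
  refine Set.infinite_of_injective_forall_mem (f := fun s => perpHyperplane _ _ (hne s))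
    (fun s r h => ?_) fun s => (hmem s P).2 (by simp)
  -- The vector `(-s, 1)` spans the direction of the line with normal `(1, s)`; its product with
  -- `(1, r)` is `r - s`, so the lines are distinct.
  have h1 : P + !₂[-s, 1] ∈ (perpHyperplane _ _ (hne s)).points :=
    (hmem _ _).2 (by simp [v, PiLp.inner_apply, Fin.sum_univ_two])
  have h2 : perpHyperplane _ _ (hne s) = perpHyperplane _ _ (hne r) := h
  rw [h2, hmem] at h1
  simp [v, PiLp.inner_apply, Fin.sum_univ_two] at h1
  linarith

theorem Hyperplane.eq_of_mem_of_mem {Δ Δ' : Hyperplane 2} {P Q : E 2} (h : P ≠ Q)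
    (hP : P ∈ Δ.points) (hQ : Q ∈ Δ.points) (hP' : P ∈ Δ'.points) (hQ' : Q ∈ Δ'.points) :
    Δ = Δ' := by
  obtain ⟨x₀, e, -, hm⟩ := Δ.exists_param
  refine Hyperplane.eq_of_points_subset fun x hx => ?_
  obtain ⟨n, t, -, hn⟩ := Hyperplane.exists_normal Δ'
  obtain ⟨p, rfl⟩ := (hm _).1 hP
  obtain ⟨q, rfl⟩ := (hm _).1 hQ
  obtain ⟨s, rfl⟩ := (hm _).1 hx
  rw [hn, inner_add_right, inner_smul_right] at hP' hQ' ⊢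
  have hpq : p - q ≠ 0 := fun h0 => h (by rw [sub_eq_zero.1 h0])
  have h1 : ⟪n, e⟫ = 0 := (mul_eq_zero.1 (show (p - q) * ⟪n, e⟫ = 0 by linarith)).resolve_left hpq
  rw [h1] at hP' ⊢
  linarith

theorem ncard_foldLines_throughTwoPoints_le (P Q : E 2)
    (hfin : (foldLines [.pointFixed P, .pointFixed Q]).Finite) :
    (foldLines [.pointFixed P, .pointFixed Q]).ncard ≤ 3 := by
  have hmem : ∀ Δ, Δ ∈ foldLines [.pointFixed P, .pointFixed Q] ↔
      P ∈ Δ.points ∧ Q ∈ Δ.points := fun Δ => by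
    simp [foldLines, PlanarIncidence.Holds, fold_eq_self_iff]
  by_cases h : P = Q
  · subst h
    exact absurd (hfin.subset fun Δ hΔ => (hmem Δ).2 ⟨hΔ, hΔ⟩) (infinite_lines_through P)
  · refine ncard_le_three_of_subsingleton fun Δ hΔ Δ' hΔ' => ?_
    rw [hmem] at hΔ hΔ'
    exact Hyperplane.eq_of_mem_of_mem h hΔ.1 hΔ.2 hΔ'.1 hΔ'.2

theorem ncard_foldLines_pointToPoint_le (P Q : E 2) (h : P ≠ Q) :
    (foldLines [.pointToPoint P Q h]).ncard ≤ 3 := by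
  have hmem : ∀ Δ, Δ ∈ foldLines [.pointToPoint P Q h] ↔ fold Δ P = Q := fun Δ => by
    simp [foldLines, PlanarIncidence.Holds]
  refine ncard_le_three_of_subsingleton fun Δ hΔ Δ' hΔ' => ?_
  rw [eq_perpHyperplane ((hmem Δ).1 hΔ) h, eq_perpHyperplane ((hmem Δ').1 hΔ') h]

/-- The condition that the fold of `P` onto `x₀ + s e` places `Q` onto the line `⟪a, x⟫ = t`,
as a cubic equation for `s`. -/
theorem fold_mem_iff_cubic {n : Hyperplane 2} {a : E 2} {t : ℝ}
    (hn : ∀ x, x ∈ n.points ↔ ⟪a, x⟫ = t) (P Q x₀ e : E 2) (s : ℝ) (hne : P ≠ x₀ + s • e) :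
    fold (perpHyperplane P (x₀ + s • e) hne) Q ∈ n.points ↔
      (⟪e, e⟫ * ⟪a, e⟫) * s ^ 3 +
      ((⟪a, Q⟫ - t) * ⟪e, e⟫ - 2 * ⟪e, Q - P⟫ * ⟪a, e⟫ + 2 * ⟪x₀ - P, e⟫ * ⟪a, e⟫ +
        ⟪e, e⟫ * ⟪a, x₀ - P⟫) * s ^ 2 +
      ((⟪a, Q⟫ - t) * (2 * ⟪x₀ - P, e⟫) - 2 * ⟪e, Q - P⟫ * ⟪a, x₀ - P⟫ -
        2 * ⟪x₀ - P, Q - P⟫ * ⟪a, e⟫ + 2 * ⟪x₀ - P, e⟫ * ⟪a, x₀ - P⟫ +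
        ⟪x₀ - P, x₀ - P⟫ * ⟪a, e⟫) * s +
      ((⟪a, Q⟫ - t) * ⟪x₀ - P, x₀ - P⟫ - 2 * ⟪x₀ - P, Q - P⟫ * ⟪a, x₀ - P⟫ +
        ⟪x₀ - P, x₀ - P⟫ * ⟪a, x₀ - P⟫) = 0 := by
  have hw : x₀ + s • e - P ≠ 0 := sub_ne_zero.2 hne.symm
  have hN : ⟪x₀ + s • e - P, x₀ + s • e - P⟫ ≠ 0 := inner_self_ne_zero.2 hw
  have e1 : x₀ + s • e - P = (x₀ - P) + s • e := by abel
  -- Written in `w = x₀ + s • e - P` and `Q - P`, the reflection formula has the denominator `⟪w,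
  -- w⟫`; clearing it leaves degree three in `s`.
  have e2 : 2 * ⟪x₀ + s • e - P, Q⟫ - (⟪x₀ + s • e, x₀ + s • e⟫ - ⟪P, P⟫) =
      2 * ⟪x₀ + s • e - P, Q - P⟫ - ⟪x₀ + s • e - P, x₀ + s • e - P⟫ := by
    generalize x₀ + s • e = Y
    simp only [inner_sub_left, inner_sub_right, real_inner_comm Y P]
    ring
  rw [hn, fold_perpHyperplane, e2, inner_sub_right a Q, inner_smul_right, div_mul_eq_mul_div,
    sub_eq_iff_eq_add, ← sub_eq_iff_eq_add', eq_div_iff hN, e1]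
  generalize x₀ - P = w
  generalize Q - P = g
  simp only [inner_add_left, inner_add_right, inner_smul_left, inner_smul_right, conj_trivial,
    real_inner_comm w e]
  constructor <;> intro h <;> linear_combination h

theorem ncard_foldLines_pointsToLines_le (P : E 2) (m : Hyperplane 2) (h : P ∉ m.points)
    (Q : E 2) (n : Hyperplane 2) (h' : Q ∉ n.points)
    (hfin : (foldLines [.pointToLine P m h, .pointToLine Q n h']).Finite) :
    (foldLines [.pointToLine P m h, .pointToLine Q n h']).ncard ≤ 3 := by
  have hmem : ∀ Δ, Δ ∈ foldLines [.pointToLine P m h, .pointToLine Q n h'] ↔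
      fold Δ P ∈ m.points ∧ fold Δ Q ∈ n.points := fun Δ => by
    simp [foldLines, PlanarIncidence.Holds]
  obtain ⟨x₀, e, he, hm⟩ := m.exists_param
  obtain ⟨a, t, ha, hn⟩ := Hyperplane.exists_normal n
  have hne : ∀ s : ℝ, P ≠ x₀ + s • e := fun s h0 => h ((hm P).2 ⟨s, h0⟩)
  have hcubic := fun s => fold_mem_iff_cubic hn P Q x₀ e s (hne s)
  refine ncard_le_three_of_cubic h hm (fun Δ hΔ => ((hmem Δ).1 hΔ).1) _ _ _ _ ?_
    fun Δ hΔ s hs => (hcubic s).1 (eq_perpHyperplane hs (hne s) ▸ ((hmem Δ).1 hΔ).2)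
  -- If the cubic vanishes identically, every point of `m` is the image of `P` under an admissible
  -- fold, against finiteness.
  rintro ⟨h3, h2, h1, h0⟩
  refine Set.infinite_of_injective_forall_mem (f := fun s => perpHyperplane _ _ (hne s))
    (fun s r hsr => ?_) (fun s => (hmem _).2 ⟨?_, ?_⟩) hfin
  · have h4 : x₀ + s • e = x₀ + r • e := by
      rw [← fold_perpHyperplane_left (hne s), ← fold_perpHyperplane_left (hne r)]
      exact congrArg (fun Δ => fold Δ P) hsr
    exact smul_left_injective ℝ he (add_left_cancel h4)
  · rw [fold_perpHyperplane_left, hm]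
    exact ⟨s, rfl⟩
  · rw [hcubic, h3, h2, h1, h0]
    ring

/-- Choose `X` on `m` off `n`, and a direction vector `g` of `m`. Every admissible fold places `X`
and `X + g` on `n`, which gives a polynomial equation for the image of `X`. It is non-trivial
whether or not the lines are parallel. -/
theorem ncard_foldLines_lineToLine_le (m n : Hyperplane 2) (h : m ≠ n) :
    (foldLines [.lineToLine m n h]).ncard ≤ 3 := by
  have hmem : ∀ Δ, Δ ∈ foldLines [.lineToLine m n h] ↔ fold Δ '' m.points = n.points :=
    fun Δ => by simp [foldLines, PlanarIncidence.Holds]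
  obtain ⟨X, hX, hXn⟩ : ∃ X ∈ m.points, X ∉ n.points := by
    by_contra! h0
    exact h (Hyperplane.eq_of_points_subset h0)
  obtain ⟨y₀, g, hg, hmg⟩ := m.exists_param
  obtain ⟨x₀, e, he, hne⟩ := n.exists_param
  obtain ⟨a, t, ha, hn⟩ := Hyperplane.exists_normal n
  have hXg : X + g ∈ m.points := by
    obtain ⟨s, rfl⟩ := (hmg _).1 hX
    exact (hmg _).2 ⟨s + 1, by rw [add_smul, one_smul, add_assoc]⟩
  have hx₀ : ⟪a, x₀⟫ = t := (hn _).1 ((hne _).2 ⟨0, by simp⟩)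
  have hae : ⟪a, e⟫ = 0 := by
    have := (hn _).1 ((hne _).2 ⟨1, rfl⟩)
    rw [inner_add_right, one_smul] at this
    linarith
  have hne' : ∀ s : ℝ, X ≠ x₀ + s • e := fun s h0 => hXn ((hne X).2 ⟨s, h0⟩)
  refine ncard_le_three_of_cubic hXn hne
    (fun Δ hΔ => (hmem Δ).1 hΔ ▸ Set.mem_image_of_mem _ hX) _ _ _ _ ?_
    fun Δ hΔ s hs => (fold_mem_iff_cubic hn X (X + g) x₀ e s (hne' s)).1
      (eq_perpHyperplane hs (hne' s) ▸ (hmem Δ).1 hΔ ▸ Set.mem_image_of_mem _ hXg)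
  rintro ⟨-, h2, h1, -⟩
  have hee : ⟪e, e⟫ ≠ 0 := inner_self_ne_zero.2 he
  rw [hn] at hXn
  -- As `⟪a, e⟫ = 0`, the quadratic coefficient is `⟪a, g⟫ * ⟪e, e⟫`. If it vanishes, then `g = r •
  -- e`, and the linear coefficient is `2 * r * (⟪a, X⟫ - t) * ⟪e, e⟫ ≠ 0`.
  simp only [add_sub_cancel_left, hae, inner_add_right, inner_sub_right a, hx₀] at h2 h1
  have hag : ⟪a, g⟫ = 0 := by
    refine (mul_eq_zero.1 (?_ : ⟪a, g⟫ * ⟪e, e⟫ = 0)).resolve_right hee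
    linear_combination h2
  have hge : ∃ r : ℝ, g = r • e := by
    obtain ⟨r, hr⟩ := (hne (x₀ + g)).1 ((hn _).2 (by rw [inner_add_right, hx₀, hag, add_zero]))
    exact ⟨r, add_left_cancel hr⟩
  obtain ⟨r, rfl⟩ := hge
  rw [hag, inner_smul_right] at h1
  have h3 : r * (⟪a, X⟫ - t) * ⟪e, e⟫ = 0 := by linear_combination h1 / 2
  have hr : r ≠ 0 := by rintro rfl; exact hg (zero_smul _ _)
  exact mul_ne_zero (mul_ne_zero hr (sub_ne_zero.2 hXn)) hee h3

theorem ncard_foldLines_perpendicularThrough_le (P : E 2) (m : Hyperplane 2) :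
    (foldLines [.pointFixed P, .lineReversed m]).ncard ≤ 3 := by
  have hmem : ∀ Δ, Δ ∈ foldLines [.pointFixed P, .lineReversed m] ↔
      P ∈ Δ.points ∧ PlanarIncidence.Holds Δ (.lineReversed m) := fun Δ => by
    simp [foldLines, PlanarIncidence.Holds, fold_eq_self_iff]
  obtain ⟨x₀, e, he, hm⟩ := m.exists_param
  refine ncard_le_three_of_subsingleton fun Δ hΔ Δ' hΔ' => ?_
  rw [hmem] at hΔ hΔ'
  obtain ⟨t, ht⟩ := exists_of_reversed hm hΔ.2
  obtain ⟨t', ht'⟩ := exists_of_reversed hm hΔ'.2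
  refine Hyperplane.ext_points fun x => ?_
  rw [ht, ht', ← (ht P).1 hΔ.1, ← (ht' P).1 hΔ'.1]

/-- The image of `P` lies on the circle about `Q` through `P`, which meets the line `m` in the roots
of a quadratic with leading coefficient `⟪e, e⟫ ≠ 0`. -/
theorem ncard_foldLines_pointToLineThrough_le (P : E 2) (m : Hyperplane 2) (h : P ∉ m.points)
    (Q : E 2) : (foldLines [.pointToLine P m h, .pointFixed Q]).ncard ≤ 3 := by
  have hmem : ∀ Δ, Δ ∈ foldLines [.pointToLine P m h, .pointFixed Q] ↔
      fold Δ P ∈ m.points ∧ fold Δ Q = Q := fun Δ => by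
    simp [foldLines, PlanarIncidence.Holds]
  obtain ⟨x₀, e, he, hm⟩ := m.exists_param
  refine ncard_le_three_of_cubic h hm (fun Δ hΔ => ((hmem Δ).1 hΔ).1) 0 ⟪e, e⟫ (2 * ⟪x₀ - Q, e⟫)
    (⟪x₀ - Q, x₀ - Q⟫ - ⟪P - Q, P - Q⟫) (fun h0 => he (inner_self_eq_zero.1 h0.2.1))
    fun Δ hΔ s hs => ?_
  have h1 := dist_fold_of_mem ((hmem Δ).1 hΔ).2 P
  rw [hs, dist_eq_norm, dist_eq_norm, add_sub_right_comm] at h1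
  have h2 : ⟪x₀ - Q + s • e, x₀ - Q + s • e⟫ = ⟪P - Q, P - Q⟫ := by
    rw [real_inner_self_eq_norm_sq, real_inner_self_eq_norm_sq, h1]
  rw [← h2]
  generalize x₀ - Q = w
  simp only [inner_add_left, inner_add_right, inner_smul_left, inner_smul_right, conj_trivial,
    real_inner_comm w e]
  ring

/-- All fold lines that reverse `n` are parallel, so `eq_of_fold_mem` leaves at most one. -/
theorem ncard_foldLines_pointToLinePerpendicular_le (P : E 2) (m : Hyperplane 2)
    (h : P ∉ m.points) (n : Hyperplane 2) :
    (foldLines [.pointToLine P m h, .lineReversed n]).ncard ≤ 3 := by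
  have hmem : ∀ Δ, Δ ∈ foldLines [.pointToLine P m h, .lineReversed n] ↔
      fold Δ P ∈ m.points ∧ PlanarIncidence.Holds Δ (.lineReversed n) := fun Δ => by
    simp [foldLines, PlanarIncidence.Holds]
  obtain ⟨x₀, e, he, hn⟩ := n.exists_param
  obtain ⟨a, t, ha, hm⟩ := Hyperplane.exists_normal m
  refine ncard_le_three_of_subsingleton fun Δ hΔ Δ' hΔ' => ?_
  rw [hmem] at hΔ hΔ'
  obtain ⟨u, hu⟩ := exists_of_reversed hn hΔ.2
  obtain ⟨u', hu'⟩ := exists_of_reversed hn hΔ'.2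
  refine eq_of_fold_mem (a := a) (d := -t) (w := e) (fun x => ?_) h hΔ.1 hΔ'.1
    (r := -(2 * (⟪e, P⟫ - u) / ⟪e, e⟫)) (r' := -(2 * (⟪e, P⟫ - u') / ⟪e, e⟫)) ?_ ?_
  · rw [hm, ← sub_eq_add_neg, sub_eq_zero]
  · rw [fold_eq_of_normal he hu, neg_smul, sub_eq_add_neg]
  · rw [fold_eq_of_normal he hu', neg_smul, sub_eq_add_neg]

theorem ncard_foldLines_alongLine_le (m : Hyperplane 2) : (foldLines [.lineFixed m]).ncard ≤ 3 := by
  have hsub : ∀ Δ ∈ foldLines [.lineFixed m], m = Δ := fun Δ hΔ => by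
    have h1 : PlanarIncidence.Holds Δ (.lineFixed m) := hΔ _ (by simp)
    exact Hyperplane.eq_of_points_subset fun x hx => fold_eq_self_iff.1 (h1.2 x hx)
  exact ncard_le_three_of_subsingleton fun Δ hΔ Δ' hΔ' => (hsub Δ hΔ).symm.trans (hsub Δ' hΔ')

theorem ncard_foldLines_le_three {L : List PlanarIncidence} (hL : IsPlanarOperation L)
    (hfin : (foldLines L).Finite) : (foldLines L).ncard ≤ 3 := by
  cases hL with
  | throughTwoPoints P Q => exact ncard_foldLines_throughTwoPoints_le P Q hfin
  | pointToPoint P Q h => exact ncard_foldLines_pointToPoint_le P Q h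
  | lineToLine m n h => exact ncard_foldLines_lineToLine_le m n h
  | perpendicularThrough P m => exact ncard_foldLines_perpendicularThrough_le P m
  | pointToLineThrough P m h Q => exact ncard_foldLines_pointToLineThrough_le P m h Q
  | pointsToLines P m h Q n h' => exact ncard_foldLines_pointsToLines_le P m h Q n h' hfin
  | pointToLinePerpendicular P m h n => exact ncard_foldLines_pointToLinePerpendicular_le P m h n
  | alongLine m => exact ncard_foldLines_alongLine_le m

end Origami

end

theorem mainTheorem4
    (P Q R : Origami.E 3) (π τ ρ : Origami.Hyperplane 3)
    (hP : P ∉ π.points) (hQ : Q ∉ τ.points) (hR : R ∉ ρ.points)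
    (a b c : Origami.E 3) (d e f : ℝ)
    (hπ : Origami.HasEquation π a d) (hτ : Origami.HasEquation τ b e)
    (hρ : Origami.HasEquation ρ c f) :
    -- the system has at most nine complex solutions, if their number is finite
    ((Origami.complexSolutions P Q R a b c d e f).Finite →
      (Origami.complexSolutions P Q R a b c d e f).ncard ≤ 9) ∧
    -- at least two solutions are non-real, if neither `τ` nor `ρ` is parallel to `π`
    (¬ τ.1.Parallel π.1 → ¬ ρ.1.Parallel π.1 →
      2 ≤ {s ∈ Origami.complexSolutions P Q R a b c d e f |
        ¬ Origami.IsRealSolution s}.encard) ∧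
    -- the real solutions are the fold planes of the operation
    Set.BijOn (Origami.solutionPlane Q)
      {s ∈ Origami.complexSolutions P Q R a b c d e f | Origami.IsRealSolution s}
      (Subtype.val '' Origami.foldPlanes P Q R π τ ρ) ∧
    -- there are at most seven fold planes, if their number is finite
    ((Origami.foldPlanes P Q R π τ ρ).Finite →
      (Origami.foldPlanes P Q R π τ ρ).ncard ≤ 7) ∧
    -- an operation of planar origami with finitely many fold lines has at most three
    (∀ L : List Origami.PlanarIncidence, Origami.IsPlanarOperation L →
      (Origami.foldLines L).Finite → (Origami.foldLines L).ncard ≤ 3) := by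
  have ha := hπ.ne_zero hP
  have hb := hτ.ne_zero hQ
  have hc := hρ.ne_zero hR
  have hβ : inner ℝ b Q + e ≠ 0 := fun h => hQ ((hτ Q).2 h)
  have hγ : inner ℝ c R + f ≠ 0 := fun h => hR ((hρ R).2 h)
  have hbij := Origami.bijOn_solutionPlane hP hQ hR hπ hτ hρ
  refine ⟨Origami.ncard_complexSolutions_le_nine hc hβ hγ, fun h1 h2 => ?_, hbij, fun hfin => ?_,
    fun L hL => Origami.ncard_foldLines_le_three hL⟩
  · exact Origami.two_le_encard_nonreal ha hγ (fun μ h => h1 (hπ.parallel hτ hb h))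
      fun μ h => h2 (hπ.parallel hρ hc h)
  · have himg : (Subtype.val '' Origami.foldPlanes P Q R π τ ρ).ncard = _ :=
      Set.ncard_image_of_injective _ Subtype.val_injective
    refine himg.symm.trans_le ?_
    rw [← hbij.image_eq, hbij.injOn.ncard_image]
    refine Origami.ncard_realSolutions_le_seven ha hb hc hβ hγ ?_
    rw [← Set.finite_image_iff hbij.injOn, hbij.image_eq]
    exact hfin.image _
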